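/- A \emph{Gauss diagram} is an oriented circle with finitely many chords with pairwise distinct ends, considered up to orientation-preserving isomorphism; it encodes an oriented framed $4$-valent graph with one unicursal component (chords correspond to vertices). It is read from a base point as a word in which each chord name occurs exactly twice. An \emph{oriented free knot} is an equivalence class of Gauss diagrams modulo the three Reidemeister moves (for all words $x,y,z$, up to cyclic rotation and renaming of chords): (1) $aax\leftrightarrow x$; (2) $p\,x\,q\,y\leftrightarrow xy$, where each of $p,q$ is $ab$ or $ba$; (3) $p\,x\,q\,y\,r\,z\leftrightarrow \bar p\,x\,\bar q\,y\,\bar r\,z$, where $p\in\{ab,ba\}$, $q\in\{ac,ca\}$, $r\in\{bc,cb\}$ and the bar reverses a two-letter word. The inverse $\bar K$ of $K$ is obtained by reversing the orientation of the circle. Let $L=L_1\cup L_2$ be the two-component framed $4$-graph with $11$ crossings, each formed by both components, such that $L_1$ passes the crossings in the cyclic order $A_0,A_1,\dots,A_{10}$ and $L_2$ passes them in the cyclic order $$A_0,A_8,A_4,A_1,A_6,A_{10},A_2,A_9,A_5,A_3,A_7 ;$$ equivalently, the distances along $L_2$ from $A_i$ to $A_{i+1}$ ($i$ modulo $11$)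 are $3,3,3,4,6,7,6,2,6,9,6$ modulo $11$. Let $K$ be a Gauss diagram with exactly one chord that is linked with all the other chords (that is, its ends alternate with theirs on the circle), and suppose that smoothing $K$ along this chord, in the way that gives two components, yields a framed graph isomorphic to $L$ (disregarding orientations): that is, $K$ reads $c\,X\,c\,Y$, where $c$ is this chord and $X$ and $Y$ are the cyclic words of the two components. Then the oriented free knot represented by $K$ is not equivalent to its inverse $\bar K$. An explicit such $K$, with chords $0,1,\dots,11$, is given by the cyclic word $$11,\,0,1,2,3,4,5,6,7,8,9,10,\,11,\,6,10,2,9,5,3,7,0,8,4,1 ,$$ where chord $11$ is the one linked with all the others. In particular, there is an oriented free knot that is not equivalent to its inverse. -/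

import Mathlib

namespace FreeKnots

/-- A Gauss diagram on an oriented circle (an oriented framed `4`-valent graph with exactly one
unicursal component): going once around the circle from some base point one reads a word in which
the name of every chord (every vertex of the graph) occurs exactly twice. The empty word is the
free loop. The base point and the names of the chords are immaterial: see `rotate` and `relabel`
in `Step`. -/
structure GaussDiagram where
  word : List ℕ
  double : ∀ c ∈ word, word.count c = 2

namespace GaussDiagram

/-- Elementary transformations of the words of oriented Gauss diagrams.

In `reidemeister2` the arcs `p` and `q` both carry one end of each of the chords `a`, `b`, in any
order. In `reidemeister3` the three arcs `p`, `q`, `r` carry the adjacent ends of `{a, b}`,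
`{a, c}`, `{b, c}`, each pair in any order, and on each of the three arcs the two ends are
exchanged. The pieces `x`, `y`, `z` of the circle are not touched. That `a`, `b`, `c` are distinct
is automatic, since each chord occurs exactly twice. -/
inductive Step : List ℕ → List ℕ → Prop
  | rotate (x y : List ℕ) : Step (x ++ y) (y ++ x)
  | relabel (σ : Equiv.Perm ℕ) (x : List ℕ) : Step x (x.map σ)
  | reidemeister1 (a : ℕ) (x : List ℕ) : Step (a :: a :: x) x
  | reidemeister2 (a b : ℕ) (p q x y : List ℕ) (hp : p.Perm [a, b]) (hq : q.Perm [a, b]) :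
      Step (p ++ x ++ q ++ y) (x ++ y)
  | reidemeister3 (a b c : ℕ) (p q r x y z : List ℕ)
      (hp : p.Perm [a, b]) (hq : q.Perm [a, c]) (hr : r.Perm [b, c]) :
      Step (p ++ x ++ q ++ y ++ r ++ z) (p.reverse ++ x ++ q.reverse ++ y ++ r.reverse ++ z)

/-- Two Gauss diagrams represent the same oriented free knot: they are related by a finite
sequence of isomorphisms and Reidemeister moves (and inverse moves), through Gauss diagrams. -/
def Equivalent : GaussDiagram → GaussDiagram → Prop :=
  Relation.EqvGen fun D D' => Step D.word D'.word

/-- The same Gauss diagram with the orientation of the circle reversed. -/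
def inverse (D : GaussDiagram) : GaussDiagram where
  word := D.word.reverse
  double := fun c hc => by
    rw [List.count_reverse]
    exact D.double c (List.mem_reverse.mp hc)

/-- The distinct chords `c` and `d` are linked: their ends alternate on the circle. -/
def Linked (D : GaussDiagram) (c d : ℕ) : Prop :=
  ∃ x y : List ℕ, D.word ~r (c :: x ++ c :: y) ∧ d ∈ x ∧ d ∈ y

/-- The chord `c` is linked with all the other chords. -/
def LinkedWithAll (D : GaussDiagram) (c : ℕ) : Prop :=
  c ∈ D.word ∧ ∀ d ∈ D.word, d ≠ c → D.Linked c d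

/-- Smoothing the crossing `c` in the way that gives a two-component link: the two components are
the circles with cyclic words `X` and `Y`. -/
def SmoothsTo (D : GaussDiagram) (c : ℕ) (X Y : List ℕ) : Prop :=
  D.word ~r (c :: X ++ c :: Y)

end GaussDiagram

/-- Two cyclic words describe the same unoriented circle. -/
def SameCircle (X Y : List ℕ) : Prop := X ~r Y ∨ X ~r Y.reverse

/-- The first component `L₁` of the link `L`: the crossings `A₀, …, A₁₀` in cyclic order. -/
def circleL1 : List ℕ := [0, 1, 2, 3, 4, 5, 6, 7, 8, 9, 10]

/-- The second component `L₂` of the link `L`: the cyclic order in which it meets the crossings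
`A₀, …, A₁₀`. -/
def circleL2 : List ℕ := [0, 8, 4, 1, 6, 10, 2, 9, 5, 3, 7]

/-- The distances along `L₂` between the cyclically consecutive crossings `Aᵢ`, `Aᵢ₊₁` of `L₁`. -/
def distances : Fin 11 → ZMod 11 := ![3, 3, 3, 4, 6, 7, 6, 2, 6, 9, 6]

/-- The order of the crossings on `L₂` is the one determined by the sequence of distances. -/
theorem circleL2_distances : circleL2.Perm circleL1 ∧ ∀ i : Fin 11,
    (circleL2.idxOf ((i + 1 : Fin 11) : ℕ) : ZMod 11) - (circleL2.idxOf (i : ℕ) : ZMod 11)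
      = distances i := by
  decide

/-- The two-component framed `4`-graph all of whose crossings are formed by both of its components,
the circles `X` and `Y`, is isomorphic to `L = L₁ ∪ L₂` (disregarding orientations). -/
def IsLinkL (X Y : List ℕ) : Prop :=
  ∃ σ : Equiv.Perm ℕ, SameCircle (X.map σ) circleL1 ∧ SameCircle (Y.map σ) circleL2

/-- The Gauss diagrams in question: exactly one chord is linked with all the other chords, and
smoothing along this chord gives the link `L`. -/
def IsLiftOfL (K : GaussDiagram) : Prop :=
  (∃! c, K.LinkedWithAll c) ∧
    ∃ c X Y, K.LinkedWithAll c ∧ K.SmoothsTo c X Y ∧ IsLinkL X Y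

/-- An explicit Gauss diagram with twelve chords. -/
def diagramK : GaussDiagram where
  word := [11, 0, 1, 2, 3, 4, 5, 6, 7, 8, 9, 10, 11, 6, 10, 2, 9, 5, 3, 7, 0, 8, 4, 1]
  double := by decide

end FreeKnots

/-!
The proof computes a state sum. Choose a finite set of colours and a tensor `U` with entries in a
commutative ring; colour the arcs of a Gauss diagram in all possible ways, give every chord the
entry of `U` at the four colours around it, multiply over the chords and sum over the colourings.
The result is an invariant of oriented free knots if `U` satisfies the identities of
`IsInvariantTensor` (`stateSum_eq_of_equivalent`).

The tensor (`linkTensor`) is built from the link `L`, over a ring of characteristic two with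
elements `z`, `g` such that `z * z = 0`, `g * g = 1` and `z * g ≠ z`. There are two families of
colours: the directed arcs of the first circle, and the arcs of the second circle. At a chord with
four colours of the same family the two strands are smoothed in both ways. At a chord where strands
of both families meet, either nothing happens, or the chord is identified with a crossing of `L` and
both strands move to the next arcs of their circles; in either case the factor is `g` if the strand
of the first family runs in the positive direction, and `1` otherwise. Finally, a chord can be
smoothed so that its strands exchange their families, with the factor `z`. The main condition for
invariance is that crossing twice is the identity (`linkCrossing_isMixedTensor`); it holds because
no two crossings of `L` are adjacent on both circles. An isolated arc is added to each circle to
make the number of arcs even.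

To evaluate the state sum at a diagram with twelve chords, compare `linkTensor` with the tensor
`trivialTensor` in which no chord is identified with a crossing. The latter has state sum zero by a
free involution of the colours. So only the colourings with at least one identified chord count. For
these a conservation law (`potential_balance`) shows that the number of chords identified with a
given crossing of `L` is the same for all eleven crossings. Hence each of these numbers is one, and
exactly one chord is left, at which the families are exchanged (`exists_isContribution`). This chord
is linked with all the others (`IsContribution.alternate`), so it is the distinguished chord `c`.
What remains is a map from the crossings of `L` to themselves that respects the circles. As `L` has
no symmetry other than the identity, even if circles may be exchanged or reversed (`labels_eq_id`,
`labels_not_exchanged`), a single colouring is left, and the state sum is `z * g` or `z` according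
to the orientation of the first circle (`stateSum_lift`). Reversing the diagram exchanges these two
values.
-/

namespace FreeKnots

/-! ### State sums over coloured words -/

section StateSum

variable {C R : Type*} [CommRing R]

/-- The factor of a chord whose two ends are passed by the steps in the list. A chord of a Gauss
diagram has two ends; the value at lists of any other length is arbitrary. -/
def pairWeight (U : C → C → C → C → R) : List (C × C) → R
  | [(i, j), (k, l)] => U i j k l
  | _ => 1

/-- The weight of a colouring: the product over the chords of the entries of the tensor `U`. -/
def weight (U : C → C → C → C → R) (s : List (ℕ × C × C)) : R :=
  ∏ c ∈ (s.map Prod.fst).toFinset, pairWeight U ((s.filter (·.1 = c)).map Prod.snd)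

variable {U : C → C → C → C → R}

theorem pairWeight_perm (hU : ∀ i j k l, U i j k l = U k l i j) {s t : List (C × C)}
    (h : s.Perm t) : pairWeight U s = pairWeight U t := by
  by_cases hs : s.length = 2
  · obtain ⟨a, b, rfl⟩ := List.length_eq_two.mp hs
    obtain ⟨c, d, rfl⟩ := List.length_eq_two.mp (h.length_eq.symm.trans hs)
    rw [List.perm_pair] at h
    rcases h with ⟨rfl, rfl⟩ | ⟨rfl, rfl⟩
    · rfl
    · exact hU ..
  · have ht : t.length ≠ 2 := h.length_eq ▸ hs
    have key : ∀ l : List (C × C), l.length ≠ 2 → pairWeight U l = 1 := by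
      intro l hl
      match l with
      | [] => rfl
      | [_] => rfl
      | [_, _] => simp at hl
      | _ :: _ :: _ :: _ => rfl
    rw [key s hs, key t ht]

theorem weight_perm (hU : ∀ i j k l, U i j k l = U k l i j) {s t : List (ℕ × C × C)}
    (h : s.Perm t) : weight U s = weight U t := by
  unfold weight
  rw [List.toFinset_eq_of_perm _ _ (h.map Prod.fst)]
  exact Finset.prod_congr rfl fun c _ => pairWeight_perm hU ((h.filter _).map _)

theorem weight_cons_cons {a : ℕ} {s : List (ℕ × C × C)} (ha : a ∉ s.map Prod.fst) (i j k l : C) :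
    weight U ((a, i, j) :: (a, k, l) :: s) = U i j k l * weight U s := by
  have hs : s.filter (·.1 = a) = [] := by
    rw [List.filter_eq_nil_iff]
    intro x hx
    simp only [decide_eq_true_eq]
    rintro rfl
    exact ha (List.mem_map_of_mem hx)
  unfold weight
  simp only [List.map_cons, List.toFinset_cons, Finset.insert_idem]
  rw [Finset.prod_insert (by simpa using ha)]
  congr 1
  · simp [hs, pairWeight]
  · refine Finset.prod_congr rfl fun c hc => ?_
    have : a ≠ c := by
      rintro rfl
      exact ha (List.mem_toFinset.mp hc)
    simp [this]

theorem weight_map {σ : ℕ → ℕ} (hσ : σ.Injective) (s : List (ℕ × C × C)) :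
    weight U (s.map (Prod.map σ id)) = weight U s := by
  unfold weight
  have h : ((s.map (Prod.map σ id)).map Prod.fst).toFinset
      = (s.map Prod.fst).toFinset.image σ := by
    ext; simp
  rw [h, Finset.prod_image fun _ _ _ _ h => hσ h]
  refine Finset.prod_congr rfl fun c _ => ?_
  congr 1
  rw [List.filter_map, List.map_map]
  have h1 : (Prod.snd ∘ Prod.map σ id : ℕ × C × C → C × C) = Prod.snd := by ext <;> rfl
  have h2 : ((fun x : ℕ × C × C => decide (x.1 = σ c)) ∘ Prod.map σ id)
      = fun x => decide (x.1 = c) := by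
    ext x; simp [hσ.eq_iff]
  rw [h1, h2]

variable [Fintype C] [DecidableEq C]

/-- The colourings of the arcs of a word, from the initial colour `i` to the final colour `j`.
Passing a letter `c` changes the colour from `a` to `b`, and this is recorded as the step
`(c, a, b)`; a colouring is the list of its steps. -/
def paths : List ℕ → C → C → Finset (List (ℕ × C × C))
  | [], i, j => if i = j then {[]} else ∅
  | c :: w, i, j => Finset.univ.biUnion fun k =>
      (paths w k j).map ⟨List.cons (c, i, k), List.cons_injective⟩

theorem sum_paths_nil (i j : C) (F : List (ℕ × C × C) → R) :
    ∑ s ∈ paths [] i j, F s = if i = j then F [] else 0 := by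
  unfold paths
  split_ifs <;> simp

theorem sum_paths_cons (c : ℕ) (w : List ℕ) (i j : C) (F : List (ℕ × C × C) → R) :
    ∑ s ∈ paths (c :: w) i j, F s = ∑ k, ∑ s ∈ paths w k j, F ((c, i, k) :: s) := by
  rw [paths, Finset.sum_biUnion]
  · simp
  · intro k _ l _ hkl
    rw [Function.onFun, Finset.disjoint_left]
    intro s hs ht
    simp only [Finset.mem_map, Function.Embedding.coeFn_mk] at hs ht
    obtain ⟨s', _, rfl⟩ := hs
    obtain ⟨t', _, h⟩ := ht
    simp only [List.cons.injEq, Prod.mk.injEq, true_and] at h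
    exact hkl h.1.symm

theorem sum_paths_append (w v : List ℕ) (i j : C) (F : List (ℕ × C × C) → R) :
    ∑ s ∈ paths (w ++ v) i j, F s
      = ∑ k, ∑ s ∈ paths w i k, ∑ t ∈ paths v k j, F (s ++ t) := by
  induction w generalizing i F with
  | nil => simp [sum_paths_nil]
  | cons c w ih =>
    simp only [List.cons_append, sum_paths_cons, ih]
    rw [Finset.sum_comm]

theorem sum_paths_map (σ : ℕ → ℕ) (w : List ℕ) (i j : C) (F : List (ℕ × C × C) → R) :
    ∑ s ∈ paths (w.map σ) i j, F s = ∑ s ∈ paths w i j, F (s.map (Prod.map σ id)) := by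
  induction w generalizing i F with
  | nil => simp [sum_paths_nil]
  | cons c w ih => simp [sum_paths_cons, ih]

theorem map_fst_of_mem_paths {w : List ℕ} {i j : C} {s : List (ℕ × C × C)}
    (hs : s ∈ paths w i j) : s.map Prod.fst = w := by
  induction w generalizing i s with
  | nil =>
    unfold paths at hs
    split_ifs at hs <;> simp_all
  | cons c w ih =>
    simp only [paths, Finset.mem_biUnion, Finset.mem_map, Function.Embedding.coeFn_mk] at hs
    obtain ⟨k, _, t, ht, rfl⟩ := hs
    simp [ih ht]

/-- The state sum of a cyclic word: the sum of the weights of the closed colourings. -/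
def stateSum (U : C → C → C → C → R) (w : List ℕ) : R :=
  ∑ i, ∑ s ∈ paths w i i, weight U s

/-- The identities that make the state sum invariant under the Reidemeister moves. -/
structure IsInvariantTensor (U : C → C → C → C → R) : Prop where
  symm : ∀ i j k l, U i j k l = U k l i j
  kink : ∀ i m, ∑ k, U i k k m = if i = m then 1 else 0
  parallel : ∀ i i' j j', ∑ p : C × C, U i p.1 j p.2 * U p.1 i' p.2 j' =
    if i = i' ∧ j = j' then 1 else 0
  antiparallel : ∀ i i' j j', ∑ p : C × C, U i p.1 p.2 j' * U p.1 i' j p.2 =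
    if i = i' ∧ j = j' then 1 else 0
  triangle : ∀ i i' j j' k k',
    ∑ p : C × C × C, U i p.1 j p.2.1 * U p.1 i' k p.2.2 * U p.2.1 j' p.2.2 k' =
      ∑ p : C × C × C, U p.1 i' p.2.1 j' * U i p.1 p.2.2 k' * U j p.2.1 k p.2.2

theorem stateSum_rotate (hU : ∀ i j k l, U i j k l = U k l i j) (x y : List ℕ) :
    stateSum U (x ++ y) = stateSum U (y ++ x) := by
  simp only [stateSum, sum_paths_append]
  rw [Finset.sum_comm]
  refine Finset.sum_congr rfl fun i _ => Finset.sum_congr rfl fun k _ => ?_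
  rw [Finset.sum_comm]
  exact Finset.sum_congr rfl fun s _ => Finset.sum_congr rfl fun t _ =>
    weight_perm hU List.perm_append_comm

theorem stateSum_map {σ : ℕ → ℕ} (hσ : σ.Injective) (w : List ℕ) :
    stateSum U (w.map σ) = stateSum U w := by
  simp only [stateSum, sum_paths_map, weight_map hσ]

theorem stateSum_kink (hU : IsInvariantTensor U) {a : ℕ} {x : List ℕ} (ha : a ∉ x) :
    stateSum U (a :: a :: x) = stateSum U x := by
  simp only [stateSum, sum_paths_cons]
  refine Finset.sum_congr rfl fun i _ => ?_
  have h : ∀ k m, ∑ s ∈ paths x m i, weight U ((a, i, k) :: (a, k, m) :: s)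
      = U i k k m * ∑ s ∈ paths x m i, weight U s := by
    intro k m
    rw [Finset.mul_sum]
    refine Finset.sum_congr rfl fun s hs => weight_cons_cons ?_ ..
    rwa [map_fst_of_mem_paths hs]
  simp only [h]
  rw [Finset.sum_comm]
  simp only [← Finset.sum_mul, hU.kink]
  simp

/-- A cyclic word with three distinguished arcs: the state sum is computed by summing over the
colourings of the arcs last. -/
theorem stateSum_three_arcs (hU : ∀ i j k l, U i j k l = U k l i j) (p q r x y z : List ℕ) :
    stateSum U (p ++ x ++ q ++ y ++ r ++ z)
      = ∑ i, ∑ i', ∑ j, ∑ s ∈ paths x i' j, ∑ j', ∑ k, ∑ t ∈ paths y j' k, ∑ k',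
          ∑ u ∈ paths z k' i, ∑ v ∈ (paths p i i' ×ˢ paths q j j') ×ˢ paths r k k',
            weight U (v.1.1 ++ v.1.2 ++ v.2 ++ (s ++ t ++ u)) := by
  rw [List.append_assoc, List.append_assoc, List.append_assoc, List.append_assoc]
  refine Finset.sum_congr rfl fun i _ => ?_
  rw [sum_paths_append]
  refine Finset.sum_congr rfl fun i' _ => ?_
  rw [Finset.sum_comm, sum_paths_append]
  refine Finset.sum_congr rfl fun j _ => Finset.sum_congr rfl fun s _ => ?_
  rw [sum_paths_append]
  refine Finset.sum_congr rfl fun j' _ => ?_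
  rw [Finset.sum_comm, sum_paths_append]
  refine Finset.sum_congr rfl fun k _ => Finset.sum_congr rfl fun t _ => ?_
  rw [sum_paths_append]
  refine Finset.sum_congr rfl fun k' _ => ?_
  rw [Finset.sum_comm]
  refine Finset.sum_congr rfl fun u _ => ?_
  simp_rw [Finset.sum_product_right]
  refine Finset.sum_congr rfl fun v₃ _ => Finset.sum_congr rfl fun v₂ _ =>
    Finset.sum_congr rfl fun v₁ _ => weight_perm hU ?_
  rw [List.perm_iff_count]
  intro c
  simp only [List.count_append]
  omega

/-- The state sum does not change when three arcs are replaced by arcs that contribute the same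
when the colours of their ends and the rest of the colouring are fixed. -/
theorem stateSum_replace_arcs (hU : ∀ i j k l, U i j k l = U k l i j)
    {p q r p' q' r' x y z : List ℕ}
    (h : ∀ i i' j j' k k' S, S.map Prod.fst = x ++ y ++ z →
      ∑ v ∈ (paths p i i' ×ˢ paths q j j') ×ˢ paths r k k',
          weight U (v.1.1 ++ v.1.2 ++ v.2 ++ S) =
        ∑ v ∈ (paths p' i i' ×ˢ paths q' j j') ×ˢ paths r' k k',
          weight U (v.1.1 ++ v.1.2 ++ v.2 ++ S)) :
    stateSum U (p ++ x ++ q ++ y ++ r ++ z) = stateSum U (p' ++ x ++ q' ++ y ++ r' ++ z) := by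
  rw [stateSum_three_arcs hU, stateSum_three_arcs hU]
  refine Finset.sum_congr rfl fun i _ => Finset.sum_congr rfl fun i' _ => ?_
  refine Finset.sum_congr rfl fun j _ => Finset.sum_congr rfl fun s hs => ?_
  refine Finset.sum_congr rfl fun j' _ => Finset.sum_congr rfl fun k _ => ?_
  refine Finset.sum_congr rfl fun t ht => Finset.sum_congr rfl fun k' _ => ?_
  refine Finset.sum_congr rfl fun u hu => h _ _ _ _ _ _ _ ?_
  simp [map_fst_of_mem_paths hs, map_fst_of_mem_paths ht, map_fst_of_mem_paths hu]

theorem sum_paths_pair (a b : ℕ) (i j : C) (F : List (ℕ × C × C) → R) :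
    ∑ s ∈ paths [a, b] i j, F s = ∑ k, F [(a, i, k), (b, k, j)] := by
  simp [sum_paths_cons, sum_paths_nil]

theorem stateSum_bigon_parallel (hU : IsInvariantTensor U) {a b : ℕ} {x y : List ℕ} (hab : a ≠ b)
    (ha : a ∉ x ++ y) (hb : b ∉ x ++ y) :
    stateSum U ([a, b] ++ x ++ [a, b] ++ y) = stateSum U (x ++ y) := by
  have key := stateSum_replace_arcs (U := U) hU.symm (p := [a, b]) (q := [a, b]) (r := [])
    (p' := []) (q' := []) (r' := []) (x := x) (y := y) (z := []) ?_
  · simpa using key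
  intro i i' j j' k k' S hS
  rw [List.append_nil] at hS
  simp only [Finset.sum_product, sum_paths_pair, sum_paths_nil]
  have h : ∀ m n, weight U ([(a, i, m), (b, m, i')] ++ [(a, j, n), (b, n, j')] ++ [] ++ S)
      = U i m j n * U m i' n j' * weight U S := by
    intro m n
    rw [weight_perm hU.symm (t := (a, i, m) :: (a, j, n) :: (b, m, i') :: (b, n, j') :: S)
      (by rw [List.perm_iff_count]; intro c
          simp only [List.count_append, List.count_cons, List.count_nil]; omega),
      weight_cons_cons (by simpa [hS, hab] using ha), weight_cons_cons (by rwa [hS]), mul_assoc]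
  have h2 := hU.parallel i i' j j'
  rw [Fintype.sum_prod_type] at h2
  by_cases hk : k = k'
  · simp only [hk, if_true, h, ← Finset.sum_mul, h2, ite_and, ite_mul, one_mul, zero_mul]
    rfl
  · simp [hk]

theorem stateSum_bigon_antiparallel (hU : IsInvariantTensor U) {a b : ℕ} {x y : List ℕ}
    (hab : a ≠ b) (ha : a ∉ x ++ y) (hb : b ∉ x ++ y) :
    stateSum U ([a, b] ++ x ++ [b, a] ++ y) = stateSum U (x ++ y) := by
  have key := stateSum_replace_arcs (U := U) hU.symm (p := [a, b]) (q := [b, a]) (r := [])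
    (p' := []) (q' := []) (r' := []) (x := x) (y := y) (z := []) ?_
  · simpa using key
  intro i i' j j' k k' S hS
  rw [List.append_nil] at hS
  simp only [Finset.sum_product, sum_paths_pair, sum_paths_nil]
  have h : ∀ m n, weight U ([(a, i, m), (b, m, i')] ++ [(b, j, n), (a, n, j')] ++ [] ++ S)
      = U i m n j' * U m i' j n * weight U S := by
    intro m n
    rw [weight_perm hU.symm (t := (a, i, m) :: (a, n, j') :: (b, m, i') :: (b, j, n) :: S)
      (by rw [List.perm_iff_count]; intro c
          simp only [List.count_append, List.count_cons, List.count_nil]; omega),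
      weight_cons_cons (by simpa [hS, hab] using ha), weight_cons_cons (by rwa [hS]), mul_assoc]
  have h2 := hU.antiparallel i i' j j'
  rw [Fintype.sum_prod_type] at h2
  by_cases hk : k = k'
  · simp only [hk, if_true, h, ← Finset.sum_mul, h2, ite_and, ite_mul, one_mul, zero_mul]
    rfl
  · simp [hk]

theorem stateSum_bigon (hU : IsInvariantTensor U) {a b : ℕ} {p q x y : List ℕ} (hab : a ≠ b)
    (ha : a ∉ x ++ y) (hb : b ∉ x ++ y) (hp : p.Perm [a, b]) (hq : q.Perm [a, b]) :
    stateSum U (p ++ x ++ q ++ y) = stateSum U (x ++ y) := by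
  rw [List.perm_pair] at hp hq
  rcases hp with rfl | rfl <;> rcases hq with rfl | rfl
  · exact stateSum_bigon_parallel hU hab ha hb
  · exact stateSum_bigon_antiparallel hU hab ha hb
  · exact stateSum_bigon_antiparallel hU hab.symm hb ha
  · exact stateSum_bigon_parallel hU hab.symm hb ha

/-- The third move for a triangle whose arcs are compatible with a linear order of the chords. -/
theorem stateSum_triangle (hU : IsInvariantTensor U) {a b c : ℕ} {x y z : List ℕ} (hab : a ≠ b)
    (hac : a ≠ c) (hbc : b ≠ c) (ha : a ∉ x ++ y ++ z) (hb : b ∉ x ++ y ++ z)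
    (hc : c ∉ x ++ y ++ z) :
    stateSum U ([a, b] ++ x ++ [a, c] ++ y ++ [b, c] ++ z)
      = stateSum U ([b, a] ++ x ++ [c, a] ++ y ++ [c, b] ++ z) := by
  refine stateSum_replace_arcs hU.symm fun i i' j j' k k' S hS => ?_
  simp only [Finset.sum_product, sum_paths_pair]
  have hL : ∀ l m n, weight U ([(a, i, l), (b, l, i')] ++ [(a, j, m), (c, m, j')]
      ++ [(b, k, n), (c, n, k')] ++ S)
      = U i l j m * U l i' k n * U m j' n k' * weight U S := by
    intro l m n
    rw [weight_perm hU.symm (t := (a, i, l) :: (a, j, m) :: (b, l, i') :: (b, k, n) ::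
        (c, m, j') :: (c, n, k') :: S)
      (by rw [List.perm_iff_count]; intro c
          simp only [List.count_append, List.count_cons, List.count_nil]; omega),
      weight_cons_cons (by simpa [hS, hab, hac] using ha),
      weight_cons_cons (by simpa [hS, hbc] using hb), weight_cons_cons (by rwa [hS])]
    ring
  have hR : ∀ l m n, weight U ([(b, i, l), (a, l, i')] ++ [(c, j, m), (a, m, j')]
      ++ [(c, k, n), (b, n, k')] ++ S)
      = U l i' m j' * U i l n k' * U j m k n * weight U S := by
    intro l m n
    rw [weight_perm hU.symm (t := (a, l, i') :: (a, m, j') :: (b, i, l) :: (b, n, k') ::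
        (c, j, m) :: (c, k, n) :: S)
      (by rw [List.perm_iff_count]; intro c
          simp only [List.count_append, List.count_cons, List.count_nil]; omega),
      weight_cons_cons (by simpa [hS, hab, hac] using ha),
      weight_cons_cons (by simpa [hS, hbc] using hb), weight_cons_cons (by rwa [hS])]
    ring
  have h2 := hU.triangle i i' j j' k k'
  simp only [Fintype.sum_prod_type] at h2
  simp only [hL, hR, ← Finset.sum_mul, h2]

/-- The same move with the opposite cyclic order of the three arcs. -/
theorem stateSum_triangle' (hU : IsInvariantTensor U) {a b c : ℕ} {x y z : List ℕ} (hab : a ≠ b)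
    (hac : a ≠ c) (hbc : b ≠ c) (ha : a ∉ x ++ y ++ z) (hb : b ∉ x ++ y ++ z)
    (hc : c ∉ x ++ y ++ z) :
    stateSum U ([a, b] ++ x ++ [b, c] ++ y ++ [a, c] ++ z)
      = stateSum U ([b, a] ++ x ++ [c, b] ++ y ++ [c, a] ++ z) := by
  have h := stateSum_triangle hU (a := c) (b := b) (c := a) (x := y) (y := z) (z := x)
    hbc.symm hac.symm hab.symm (by simp at hc ⊢; tauto) (by simp at hb ⊢; tauto)
    (by simp at ha ⊢; tauto)
  have r1 := stateSum_rotate hU.symm ([a, b] ++ x) ([b, c] ++ y ++ [a, c] ++ z)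
  have r2 := stateSum_rotate hU.symm ([b, a] ++ x) ([c, b] ++ y ++ [c, a] ++ z)
  simp only [List.append_assoc] at h r1 r2 ⊢
  rw [r1, r2, h]

/-- The third move for a triangle whose arcs define a cyclic order of the chords. A bigon is created
so that a linearly ordered triangle appears; after the move on that triangle another bigon can be
removed, and the result is the required one with the chord `e` in the place of `a`. -/
theorem stateSum_cyclic_triangle (hU : IsInvariantTensor U) {a b c : ℕ} {x y z : List ℕ}
    (hab : a ≠ b) (hac : a ≠ c) (hbc : b ≠ c) (ha : a ∉ x ++ y ++ z) (hb : b ∉ x ++ y ++ z)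
    (hc : c ∉ x ++ y ++ z) :
    stateSum U ([a, b] ++ x ++ [c, a] ++ y ++ [b, c] ++ z)
      = stateSum U ([b, a] ++ x ++ [a, c] ++ y ++ [c, b] ++ z) := by
  obtain ⟨d, hd⟩ := Infinite.exists_notMem_finset (a :: b :: c :: (x ++ y ++ z)).toFinset
  obtain ⟨e, he⟩ := Infinite.exists_notMem_finset (d :: a :: b :: c :: (x ++ y ++ z)).toFinset
  simp only [List.mem_toFinset, List.mem_cons, List.mem_append, not_or] at hd he ha hb hc
  have rot := @stateSum_rotate C R _ U _ _ hU.symm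
  have h1 : stateSum U ([d, e] ++ x ++ [e, d] ++ ([c, a] ++ y ++ [b, c] ++ z ++ [a, b]))
      = stateSum U (x ++ ([c, a] ++ y ++ [b, c] ++ z ++ [a, b])) :=
    stateSum_bigon_antiparallel hU (Ne.symm he.1) (by simp; tauto) (by simp; tauto)
  have h2 : stateSum U ([b, d] ++ ([e] ++ x ++ [e]) ++ [d, c] ++ ([a] ++ y) ++ [b, c] ++ (z ++ [a]))
      = stateSum U ([d, b] ++ ([e] ++ x ++ [e]) ++ [c, d] ++ ([a] ++ y) ++ [c, b]
        ++ (z ++ [a])) := by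
    refine stateSum_triangle' hU (Ne.symm hd.2.1) hbc hd.2.2.1 ?_ ?_ ?_ <;>
      simp <;> tauto
  have h3 : stateSum U ([a, d] ++ ([b, e] ++ x ++ [e, c]) ++ [d, a] ++ (y ++ [c, b] ++ z))
      = stateSum U (([b, e] ++ x ++ [e, c]) ++ (y ++ [c, b] ++ z)) :=
    stateSum_bigon_antiparallel hU (Ne.symm hd.1) (by simp; tauto) (by simp; tauto)
  have h4 : stateSum U (([b, a] ++ x ++ [a, c] ++ y ++ [c, b] ++ z).map (Equiv.swap a e))
      = stateSum U ([b, a] ++ x ++ [a, c] ++ y ++ [c, b] ++ z) :=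
    stateSum_map (Equiv.injective _) _
  have hfix : ∀ l : List ℕ, a ∉ l → e ∉ l → l.map (Equiv.swap a e) = l := by
    intro l hl hl'
    refine (List.map_congr_left fun t ht => ?_).trans (List.map_id l)
    exact Equiv.swap_apply_of_ne_of_ne (fun h => hl (h ▸ ht)) (fun h => hl' (h ▸ ht))
  simp only [List.map_append, hfix x (by tauto) (by tauto), hfix y (by tauto) (by tauto),
    hfix z (by tauto) (by tauto), hfix [c, b] (by simp; tauto) (by simp; tauto)] at h4
  rw [← h4]
  have r1 := rot ([a, b] ++ x) ([c, a] ++ y ++ [b, c] ++ z)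
  have r2 := rot x ([c, a] ++ y ++ [b, c] ++ z ++ [a, b])
  have r3 := rot [a] ([b, d] ++ ([e] ++ x ++ [e]) ++ [d, c] ++ ([a] ++ y) ++ [b, c] ++ z)
  have r4 := rot [a] ([d, b] ++ ([e] ++ x ++ [e]) ++ [c, d] ++ ([a] ++ y) ++ [c, b] ++ z)
  have r5 := rot [a, b] ([d, e] ++ x ++ [e, d] ++ ([c, a] ++ y ++ [b, c] ++ z))
  simp only [List.append_assoc, List.cons_append, List.nil_append, List.map_cons, List.map_nil,
    Equiv.swap_apply_left, Equiv.swap_apply_of_ne_of_ne hab.symm (Ne.symm he.2.2.1),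
    Equiv.swap_apply_of_ne_of_ne hac.symm (Ne.symm he.2.2.2.1)] at h1 h2 h3 h4 r1 r2 r3 r4 r5 ⊢
  rw [r1, ← r2, ← h1, ← r5, r3, h2, ← r4, h3]

theorem stateSum_reidemeister3 (hU : IsInvariantTensor U) {a b c : ℕ} {p q r x y z : List ℕ}
    (hab : a ≠ b) (hac : a ≠ c) (hbc : b ≠ c) (ha : a ∉ x ++ y ++ z) (hb : b ∉ x ++ y ++ z)
    (hc : c ∉ x ++ y ++ z) (hp : p.Perm [a, b]) (hq : q.Perm [a, c]) (hr : r.Perm [b, c]) :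
    stateSum U (p ++ x ++ q ++ y ++ r ++ z)
      = stateSum U (p.reverse ++ x ++ q.reverse ++ y ++ r.reverse ++ z) := by
  rw [List.perm_pair] at hp hq hr
  have rot := @stateSum_rotate C R _ U _ _ hU.symm
  have ha' : a ∉ y ++ z ++ x := by simp at ha ⊢; tauto
  have hb' : b ∉ y ++ z ++ x := by simp at hb ⊢; tauto
  have hc' : c ∉ y ++ z ++ x := by simp at hc ⊢; tauto
  have ha'' : a ∉ z ++ x ++ y := by simp at ha ⊢; tauto
  have hb'' : b ∉ z ++ x ++ y := by simp at hb ⊢; tauto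
  have hc'' : c ∉ z ++ x ++ y := by simp at hc ⊢; tauto
  have rot1 : ∀ p q r : List ℕ, stateSum U (p ++ x ++ q ++ y ++ r ++ z)
      = stateSum U (q ++ y ++ r ++ z ++ p ++ x) := by
    intro p q r
    simpa using rot (p ++ x) (q ++ y ++ r ++ z)
  have rot2 : ∀ p q r : List ℕ, stateSum U (p ++ x ++ q ++ y ++ r ++ z)
      = stateSum U (r ++ z ++ p ++ x ++ q ++ y) := by
    intro p q r
    simpa using rot (p ++ x ++ q ++ y) (r ++ z)
  rcases hp with rfl | rfl <;> rcases hq with rfl | rfl <;> rcases hr with rfl | rfl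
  · exact stateSum_triangle hU hab hac hbc ha hb hc
  · rw [rot1, rot1]
    exact stateSum_triangle' hU hac hab hbc.symm ha' hc' hb'
  · exact stateSum_cyclic_triangle hU hab hac hbc ha hb hc
  · rw [rot1, rot1]
    exact stateSum_triangle hU hac.symm hbc.symm hab hc' ha' hb'
  · rw [rot1, rot1]
    exact (stateSum_triangle hU hac.symm hbc.symm hab hc' ha' hb').symm
  · exact (stateSum_cyclic_triangle hU hab hac hbc ha hb hc).symm
  · rw [rot2, rot2]
    exact stateSum_triangle hU hbc hab.symm hac.symm hb'' hc'' ha''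
  · exact (stateSum_triangle hU hab hac hbc ha hb hc).symm

/-- The state sum is an invariant of oriented free knots. -/
theorem stateSum_eq_of_equivalent (hU : IsInvariantTensor U) {D D' : GaussDiagram}
    (h : D.Equivalent D') : stateSum U D.word = stateSum U D'.word := by
  induction h with
  | refl => rfl
  | symm _ _ _ ih => exact ih.symm
  | trans _ _ _ _ _ ih₁ ih₂ => exact ih₁.trans ih₂
  | rel D D' h =>
    obtain ⟨w, hw⟩ := D
    obtain ⟨w', hw'⟩ := D'
    dsimp only at h ⊢
    cases h with
    | rotate x y => exact stateSum_rotate hU.symm x y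
    | relabel σ x => exact (stateSum_map σ.injective w).symm
    | reidemeister1 a x =>
      have := hw a (by simp)
      simp only [List.count_cons_self] at this
      exact stateSum_kink hU (List.count_eq_zero.mp (by omega))
    | reidemeister2 a b p q x y hp hq =>
      have ha := hw a (by simp [hp.mem_iff])
      have hb := hw b (by simp [hp.mem_iff])
      simp only [List.count_append, hp.count_eq, hq.count_eq, List.count_cons, List.count_nil,
        beq_iff_eq] at ha hb
      have hab : a ≠ b := by
        rintro rfl
        simp at ha
        omega
      simp only [hab, hab.symm, if_false, if_true] at ha hb
      exact stateSum_bigon hU hab (List.count_eq_zero.mp (by rw [List.count_append]; omega))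
        (List.count_eq_zero.mp (by rw [List.count_append]; omega)) hp hq
    | reidemeister3 a b c p q r x y z hp hq hr =>
      have ha := hw a (by simp [hp.mem_iff])
      have hb := hw b (by simp [hp.mem_iff])
      have hc := hw c (by simp [hr.mem_iff])
      simp only [List.count_append, hp.count_eq, hq.count_eq, hr.count_eq, List.count_cons,
        List.count_nil, beq_iff_eq] at ha hb hc
      have hab : a ≠ b := by
        rintro rfl
        simp at ha
        omega
      have hac : a ≠ c := by
        rintro rfl
        simp at ha
        omega
      have hbc : b ≠ c := by
        rintro rfl
        simp at hb
        omega
      simp only [hab, hab.symm, hac, hac.symm, hbc, hbc.symm, if_false, if_true] at ha hb hc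
      exact stateSum_reidemeister3 hU hab hac hbc
        (List.count_eq_zero.mp (by simp only [List.count_append]; omega))
        (List.count_eq_zero.mp (by simp only [List.count_append]; omega))
        (List.count_eq_zero.mp (by simp only [List.count_append]; omega)) hp hq hr

end StateSum

/-! ### Tensors on two families of colours -/

section Tensor

variable {X Y R : Type*} [CommRing R] [DecidableEq X] [DecidableEq Y]

/-- The Kronecker delta. -/
def delta (R : Type*) [CommRing R] {X : Type*} [DecidableEq X] (i j : X) : R :=
  if i = j then 1 else 0

/-- The sum of the two smoothings of a crossing whose strands change their colours from `i` to `j`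
and from `k` to `l`. The first smoothing respects the orientation of the strands; the second one
does not, and there a colour is compared with the colour `σ` of the reversed strand. -/
def bracket (R : Type*) [CommRing R] (σ : X → X) (i j k l : X) : R :=
  delta R i l * delta R j k + delta R k (σ i) * delta R l (σ j)

/-- The tensor on two families of colours `X` and `Y`. Two strands coloured by the same family cross
by the sum of the two smoothings, strands coloured by different families cross by `M`, and the
smoothing that exchanges the families of its two strands is counted with the factor `z`. -/
def tensor (z : R) (σ : X → X) (τ : Y → Y) (M : X → X → Y → Y → R) :
    X ⊕ Y → X ⊕ Y → X ⊕ Y → X ⊕ Y → R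
  | .inl i, .inl j, .inl k, .inl l => bracket R σ i j k l
  | .inr i, .inr j, .inr k, .inr l => bracket R τ i j k l
  | .inl i, .inl j, .inr k, .inr l => M i j k l
  | .inr i, .inr j, .inl k, .inl l => M k l i j
  | .inl i, .inr j, .inr k, .inl l => z * (delta R i l * delta R j k)
  | .inr i, .inl j, .inl k, .inr l => z * (delta R i l * delta R j k)
  | .inl _, .inl _, .inl _, .inr _ => 0
  | .inl _, .inl _, .inr _, .inl _ => 0
  | .inl _, .inr _, .inl _, .inl _ => 0
  | .inl _, .inr _, .inl _, .inr _ => 0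
  | .inl _, .inr _, .inr _, .inr _ => 0
  | .inr _, .inl _, .inl _, .inl _ => 0
  | .inr _, .inl _, .inr _, .inl _ => 0
  | .inr _, .inl _, .inr _, .inr _ => 0
  | .inr _, .inr _, .inl _, .inr _ => 0
  | .inr _, .inr _, .inr _, .inl _ => 0

variable [Fintype X] [Fintype Y]

/-- The conditions on the crossings of strands of different families that make `tensor` invariant:
the square of the crossing is the identity, and the crossing is unchanged when a strand is reversed,
up to the factor `g` for a strand of the first family. -/
structure IsMixedTensor (g : R) (σ : X → X) (τ : Y → Y) (M : X → X → Y → Y → R) : Prop where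
  scalar : g * g = 1
  left_involutive : σ.Involutive
  right_involutive : τ.Involutive
  flip_left : ∀ i j k l, M i j k l = g * M (σ j) (σ i) k l
  flip_right : ∀ i j k l, M i j k l = M i j (τ l) (τ k)
  parallel : ∀ i i' k k', ∑ x, ∑ y, M i x k y * M x i' y k' =
    if i = i' then (if k = k' then 1 else 0) else 0

namespace IsMixedTensor

variable {g : R} {σ : X → X} {τ : Y → Y} {M : X → X → Y → Y → R} (h : IsMixedTensor g σ τ M)
include h

/-! The identities for two strands that pass the same two crossings, for the other orientations of
the strands, and for one strand that turns back between the crossings. A primed name stands for the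
opposite order of the crossings on one strand, and the suffix `comm` for the opposite order of
summation. -/

theorem antiparallel (i i' : X) (k k' : Y) : ∑ x, ∑ y, M i x y k' * M x i' k y =
    if i = i' then (if k = k' then 1 else 0) else 0 := by
  have h1 := h.parallel i i' (τ k') (τ k)
  simp only [h.right_involutive.injective.eq_iff, eq_comm (a := k')] at h1
  rw [← h1]
  refine Finset.sum_congr rfl fun x _ => ?_
  rw [← h.right_involutive.bijective.sum_comp]
  refine Finset.sum_congr rfl fun y _ => ?_
  rw [h.flip_right i, h.flip_right x, h.right_involutive]

theorem turn_left (i j : X) (k k' : Y) : ∑ x, ∑ y, M x i k y * M (σ x) j y k' =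
    if j = σ i then (if k = k' then g else 0) else 0 := by
  have h1 := h.parallel (σ i) j k k'
  rw [← h.left_involutive.bijective.sum_comp] at h1
  calc _ = g * ∑ x, ∑ y, M (σ i) (σ x) k y * M (σ x) j y k' := by
        simp only [Finset.mul_sum, ← mul_assoc, ← h.flip_left]
    _ = _ := by rw [h1]; simp [eq_comm]

theorem turn_left' (i j : X) (k k' : Y) : ∑ x, ∑ y, M i x y k' * M j (σ x) k y =
    if j = σ i then (if k = k' then g else 0) else 0 := by
  have h1 := h.antiparallel i (σ j) k k'
  have h2 : i = σ j ↔ j = σ i := by rw [eq_comm, h.left_involutive.eq_iff]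
  calc _ = g * ∑ x, ∑ y, M i x y k' * M x (σ j) k y := by
        simp only [Finset.mul_sum, mul_left_comm g]
        refine Finset.sum_congr rfl fun x _ => Finset.sum_congr rfl fun y _ => ?_
        rw [h.flip_left j, h.left_involutive]
    _ = _ := by rw [h1]; simp [h2]

theorem turn_right (i i' : X) (k l : Y) : ∑ x, ∑ y, M i x k y * M x i' l (τ y) =
    if i = i' then (if l = τ k then 1 else 0) else 0 := by
  have h1 := h.parallel i i' k (τ l)
  have h2 : k = τ l ↔ l = τ k := by rw [eq_comm, h.right_involutive.eq_iff]
  simp only [h2] at h1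
  rw [← h1]
  refine Finset.sum_congr rfl fun x _ => Finset.sum_congr rfl fun y _ => ?_
  rw [h.flip_right x i' l, h.right_involutive]

theorem turn_right' (i i' : X) (k l : Y) : ∑ x, ∑ y, M x i' y k * M i x (τ y) l =
    if i = i' then (if k = τ l then 1 else 0) else 0 := by
  have h1 := h.parallel i i' (τ l) k
  simp only [eq_comm (b := k)] at h1
  rw [← h1]
  refine Finset.sum_congr rfl fun x _ => Finset.sum_congr rfl fun y _ => ?_
  rw [h.flip_right i x (τ y), h.right_involutive, mul_comm]

theorem turn_left_comm (i j : X) (k k' : Y) : ∑ y, ∑ x, M x j y k' * M (σ x) i k y =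
    if j = σ i then (if k = k' then g else 0) else 0 := by
  rw [← h.turn_left, Finset.sum_comm, ← h.left_involutive.bijective.sum_comp]
  simp only [h.left_involutive _, mul_comm]

theorem turn_left_comm' (i j : X) (k k' : Y) : ∑ y, ∑ x, M j x k y * M i (σ x) y k' =
    if j = σ i then (if k = k' then g else 0) else 0 := by
  rw [← h.turn_left', Finset.sum_comm, ← h.left_involutive.bijective.sum_comp]
  simp only [h.left_involutive _, mul_comm]

theorem turn_right_comm (i i' : X) (k l : Y) : ∑ y, ∑ x, M i x y k * M x i' (τ y) l =
    if i = i' then (if l = τ k then 1 else 0) else 0 := by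
  rw [← h.turn_right', Finset.sum_comm]
  refine Finset.sum_congr rfl fun x _ => ?_
  rw [← h.right_involutive.bijective.sum_comp]
  simp only [h.right_involutive _, mul_comm]

theorem turn_right_comm' (i i' : X) (k l : Y) : ∑ y, ∑ x, M x i' l y * M i x k (τ y) =
    if i = i' then (if l = τ k then 1 else 0) else 0 := by
  rw [← h.turn_right, Finset.sum_comm]
  refine Finset.sum_congr rfl fun x _ => ?_
  rw [← h.right_involutive.bijective.sum_comp]
  simp only [h.right_involutive _, mul_comm]

end IsMixedTensor

theorem sum_ite_eq_involutive {σ : X → X} (hσ : σ.Involutive) (k : X) (F : X → R) :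
    ∑ x, (if k = σ x then F x else 0) = F (σ k) := by
  have : ∀ x, k = σ x ↔ x = σ k := fun x => ⟨fun h => by rw [h, hσ], fun h => by rw [h, hσ]⟩
  simp [this]

section

variable [CharP R 2] {z g : R} {σ : X → X} {τ : Y → Y} {M : X → X → Y → Y → R}

theorem bracket_triangle (hσ : σ.Involutive) (hX : (Fintype.card X : R) = 0) (i i' j j' k k' : X) :
    ∑ x, ∑ y, ∑ w, bracket R σ i x j y * bracket R σ x i' k w * bracket R σ y j' w k' =
      ∑ x, ∑ y, ∑ w, bracket R σ x i' y j' * bracket R σ i x w k' * bracket R σ j y k w := by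
  simp only [delta, bracket, add_mul, mul_add, Finset.sum_add_distrib]
  simp [Finset.sum_ite_irrel, sum_ite_eq_involutive hσ, hσ.eq_iff, hσ _, hX]
  have hσ' : ∀ x, σ (σ x) = x := hσ
  have h2 : ∀ a : R, a + a = 0 := CharTwo.add_self_eq_zero
  grind

set_option maxHeartbeats 4000000 in
/-- The triangle identity is checked for each choice of the families of the six ends. It reduces to
the bigon identities of `M`, because at least one of the three crossings is smoothed. -/
theorem tensor_triangle (hz : z * z = 0) (h : IsMixedTensor g σ τ M) (hX : (Fintype.card X : R) = 0)
    (hY : (Fintype.card Y : R) = 0) (i i' j j' k k' : X ⊕ Y) :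
    ∑ p : (X ⊕ Y) × (X ⊕ Y) × (X ⊕ Y), tensor z σ τ M i p.1 j p.2.1 *
        tensor z σ τ M p.1 i' k p.2.2 * tensor z σ τ M p.2.1 j' p.2.2 k' =
      ∑ p : (X ⊕ Y) × (X ⊕ Y) × (X ⊕ Y), tensor z σ τ M p.1 i' p.2.1 j' *
        tensor z σ τ M i p.1 p.2.2 k' * tensor z σ τ M j p.2.1 k p.2.2 := by
  have hσ := h.left_involutive
  have hτ := h.right_involutive
  have p1 := h.parallel
  have p2 : ∀ i i' k k', ∑ y, ∑ x, M i x k y * M x i' y k' =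
      if i = i' then (if k = k' then 1 else 0) else 0 := fun i i' k k' => by
    rw [Finset.sum_comm, h.parallel]
  have p3 : ∀ i i' k k', ∑ x, ∑ y, M x i' y k' * M i x k y =
      if i = i' then (if k = k' then 1 else 0) else 0 := fun i i' k k' => by
    rw [← h.parallel]; simp only [mul_comm]
  have p4 : ∀ i i' k k', ∑ y, ∑ x, M x i' y k' * M i x k y =
      if i = i' then (if k = k' then 1 else 0) else 0 := fun i i' k k' => by
    rw [Finset.sum_comm, p3]
  have t1 := h.turn_left
  have t2 := h.turn_left_comm
  have u1 := h.turn_left'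
  have u2 := h.turn_left_comm'
  have v1 := h.turn_right
  have v2 := h.turn_right_comm
  have w1 := h.turn_right'
  have w2 := h.turn_right_comm'
  simp only [Fintype.sum_prod_type, Fintype.sum_sum_type]
  obtain i | i := i <;> obtain i' | i' := i' <;> obtain j | j := j <;> obtain j' | j' := j' <;>
    obtain k | k := k <;> obtain k' | k' := k' <;>
    simp only [tensor, mul_zero, zero_mul, Finset.sum_const_zero, add_zero, zero_add]
  case inl.inl.inl.inl.inl.inl => exact bracket_triangle hσ hX ..
  case inr.inr.inr.inr.inr.inr => exact bracket_triangle hτ hY ..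
  all_goals
    simp only [delta, bracket, add_mul, mul_add, Finset.sum_add_distrib]
    simp [Finset.sum_ite_irrel, sum_ite_eq_involutive hσ, sum_ite_eq_involutive hτ,
      mul_assoc, hz, mul_left_comm _ z, hσ.eq_iff, hτ.eq_iff, hX, hY, p1, p2, p3, p4, t1, t2,
      u1, u2, v1, v2, w1, w2, ← Finset.mul_sum]
  all_goals
    have hσ' : ∀ x, σ (σ x) = x := hσ
    have hτ' : ∀ x, τ (τ x) = x := hτ
    have h2 : ∀ a : R, a + a = 0 := CharTwo.add_self_eq_zero
    clear p1 p2 p3 p4 t1 t2 u1 u2 v1 v2 w1 w2 hz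
  case inl.inl.inr.inr.inl.inl =>
    have h3 : ∀ x, M i (σ k) j x * M (σ i') k' x j' = M (σ k') i' x j' * M k (σ i) j x := by
      intro x
      rw [h.flip_left i, h.flip_left (σ i'), hσ, hσ]
      linear_combination (M k (σ i) j x * M (σ k') i' x j') * h.scalar
    simp only [h3]
    grind
  case inr.inr.inl.inl.inr.inr =>
    have h3 : ∀ x, M j x i (τ k) * M x j' (τ i') k' = M x j' (τ k') i' * M j x k (τ i) := by
      intro x
      rw [h.flip_right j, h.flip_right x, hτ, hτ, mul_comm]
    simp only [h3]
    grind
  all_goals grind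

set_option maxHeartbeats 1000000 in
/-- The number of colours in each family is even in `R`, so closed strands count zero. -/
theorem tensor_isInvariantTensor (hz : z * z = 0) (h : IsMixedTensor g σ τ M)
    (hX : (Fintype.card X : R) = 0) (hY : (Fintype.card Y : R) = 0) :
    IsInvariantTensor (tensor z σ τ M) where
  symm i j k l := by
    have hσ' : ∀ x, σ (σ x) = x := h.left_involutive
    have hτ' : ∀ x, τ (τ x) = x := h.right_involutive
    obtain i | i := i <;> obtain j | j := j <;> obtain k | k := k <;> obtain l | l := l <;>
      simp only [tensor, bracket, delta] <;> grind
  kink i m := by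
    have hσ := h.left_involutive
    have hτ := h.right_involutive
    obtain i | i := i <;> obtain m | m := m <;>
      simp only [Fintype.sum_sum_type, tensor, bracket, delta, Finset.sum_add_distrib,
        Finset.sum_const_zero, add_zero] <;>
      simp [Finset.sum_ite_irrel, sum_ite_eq_involutive hσ, sum_ite_eq_involutive hτ, hX, hY,
        hσ.injective.eq_iff, hτ.injective.eq_iff, eq_comm]
  parallel i i' j j' := by
    have hσ := h.left_involutive
    have hτ := h.right_involutive
    have p1 := h.parallel
    have p2 : ∀ i i' k k', ∑ y, ∑ x, M i x k y * M x i' y k' =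
        if i = i' then (if k = k' then 1 else 0) else 0 := fun i i' k k' => by
      rw [Finset.sum_comm, h.parallel]
    have h2 : ∀ a : R, a + a = 0 := CharTwo.add_self_eq_zero
    obtain i | i := i <;> obtain i' | i' := i' <;> obtain j | j := j <;> obtain j' | j' := j' <;>
      simp only [Fintype.sum_prod_type, Fintype.sum_sum_type, tensor, bracket, delta,
        Finset.sum_add_distrib, add_mul, mul_add, mul_zero, zero_mul, Finset.sum_const_zero,
        add_zero, zero_add] <;>
      simp [Finset.sum_ite_irrel, hX, hY, hz, p1, p2]
    all_goals have hσ' : ∀ x, σ (σ x) = x := hσ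
    all_goals have hτ' : ∀ x, τ (τ x) = x := hτ
    all_goals clear p1 p2
    all_goals grind
  antiparallel i i' j j' := by
    have hσ := h.left_involutive
    have hτ := h.right_involutive
    have p1 := h.antiparallel
    have p2 : ∀ i i' k k', ∑ y, ∑ x, M x i' k y * M i x y k' =
        if i = i' then (if k = k' then 1 else 0) else 0 := fun i i' k k' => by
      rw [Finset.sum_comm, ← h.antiparallel]; simp only [mul_comm]
    have h2 : ∀ a : R, a + a = 0 := CharTwo.add_self_eq_zero
    obtain i | i := i <;> obtain i' | i' := i' <;> obtain j | j := j <;> obtain j' | j' := j' <;>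
      simp only [Fintype.sum_prod_type, Fintype.sum_sum_type, tensor, bracket, delta,
        Finset.sum_add_distrib, add_mul, mul_add, mul_zero, zero_mul, Finset.sum_const_zero,
        add_zero, zero_add] <;>
      simp [Finset.sum_ite_irrel, sum_ite_eq_involutive hσ, sum_ite_eq_involutive hτ, hX, hY, hσ _,
        hτ _, hσ.injective.eq_iff, hτ.injective.eq_iff, hz, p1, p2]
    all_goals have hσ' : ∀ x, σ (σ x) = x := hσ
    all_goals have hτ' : ∀ x, τ (τ x) = x := hτ
    all_goals clear p1 p2
    all_goals grind
  triangle := tensor_triangle hz h hX hY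

end
end Tensor

/-! ### The colours modelled on the two circles of the link -/

section LinkTensor

/-- The arcs `0, …, 10` of the first circle, with a direction; the arc `m` ends at the crossing `m`,
and the arc `m + 1` begins there. The arc `11` is isolated: it makes the number of arcs even. -/
abbrev LeftColour := Fin 12 × Bool

/-- The arcs `0, …, 10` of the second circle: the crossing at the position `p` lies between the arcs
`p` and `p + 1`. The arc `11` is isolated. -/
abbrev RightColour := Fin 12

/-- The positions of the crossings `0, …, 10` on the second circle. -/
def position : Fin 11 → Fin 11 := ![0, 3, 6, 9, 2, 8, 4, 10, 1, 7, 5]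

/-- A strand passes the crossing `m` along the first circle, in one of the two directions. -/
def LeftJump (m : Fin 11) (i j : LeftColour) : Prop :=
  (i = (m.castSucc, true) ∧ j = ((m + 1).castSucc, true)) ∨
    (i = ((m + 1).castSucc, false) ∧ j = (m.castSucc, false))

/-- A strand passes the crossing `m` along the second circle, in one of the two directions. -/
def RightJump (m : Fin 11) (k l : RightColour) : Prop :=
  (k = (position m).castSucc ∧ l = (position m + 1).castSucc) ∨
    (k = (position m + 1).castSucc ∧ l = (position m).castSucc)

instance (m : Fin 11) (i j : LeftColour) : Decidable (LeftJump m i j) := by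
  unfold LeftJump; infer_instance

instance (m : Fin 11) (k l : RightColour) : Decidable (RightJump m k l) := by
  unfold RightJump; infer_instance

/-- Reversal of the direction of an arc of the first circle. -/
def turn (i : LeftColour) : LeftColour := (i.1, !i.2)

theorem turn_involutive : Function.Involutive turn := fun i => by simp [turn]

theorem LeftJump.ne {m : Fin 11} {i j : LeftColour} (h : LeftJump m i j) : i ≠ j := by
  have : ∀ m : Fin 11, m ≠ m + 1 := by decide
  rcases h with ⟨rfl, rfl⟩ | ⟨rfl, rfl⟩ <;>
    simp [Fin.castSucc_inj, this m, (this m).symm]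

theorem LeftJump.snd_eq {m : Fin 11} {i j : LeftColour} (h : LeftJump m i j) : i.2 = j.2 := by
  rcases h with ⟨rfl, rfl⟩ | ⟨rfl, rfl⟩ <;> rfl

theorem LeftJump.turn_iff {m : Fin 11} {i j : LeftColour} :
    LeftJump m (turn j) (turn i) ↔ LeftJump m i j := by
  obtain ⟨i, a⟩ := i
  obtain ⟨j, b⟩ := j
  cases a <;> cases b <;> simp [LeftJump, turn, and_comm]

theorem RightJump.symm_iff {m : Fin 11} {k l : RightColour} :
    RightJump m l k ↔ RightJump m k l := by
  unfold RightJump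
  tauto

/-- Consecutive passages along the first circle. -/
theorem LeftJump.comp {m n : Fin 11} {i j k : LeftColour} (h : LeftJump m i j)
    (h' : LeftJump n j k) : i.2 = j.2 ∧ j.2 = k.2 ∧ n = if j.2 then m + 1 else m - 1 := by
  rcases h with ⟨rfl, rfl⟩ | ⟨rfl, rfl⟩ <;> rcases h' with ⟨h1, rfl⟩ | ⟨h1, rfl⟩ <;>
    simp only [Prod.mk.injEq, Fin.castSucc_inj, reduceCtorEq, and_false, and_true] at h1 ⊢
  · simp [h1]
  · simp [h1]

theorem LeftJump.label_unique {m n : Fin 11} {i j : LeftColour} (h : LeftJump m i j)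
    (h' : LeftJump n i j) : m = n := by
  rcases h with ⟨rfl, rfl⟩ | ⟨rfl, rfl⟩ <;> rcases h' with ⟨h1, h2⟩ | ⟨h1, h2⟩ <;>
    simp_all

/-- Consecutive passages along the second circle. -/
theorem RightJump.comp {m n : Fin 11} {i j k : RightColour} (h : RightJump m i j)
    (h' : RightJump n j k) : position n = position m ∨ position n = position m + 1 ∨
      position n = position m - 1 := by
  rcases h with ⟨rfl, rfl⟩ | ⟨rfl, rfl⟩ <;> rcases h' with ⟨h1, rfl⟩ | ⟨h1, rfl⟩ <;>
    simp only [Fin.castSucc_inj] at h1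
  · exact .inr (.inl h1.symm)
  · exact .inl (add_right_cancel h1).symm
  · exact .inl h1.symm
  · exact .inr (.inr (by rw [h1]; simp))

variable {R : Type*} [CommRing R]

/-- A strand of the first family is counted with the factor `g` at each crossing with the second
family that it passes in the positive direction. -/
def directionWeight (g : R) (i : LeftColour) : R := if i.2 then g else 1

/-- The crossings of strands of different families are deleted. -/
def deletedCrossing (g : R) (i j : LeftColour) (k l : RightColour) : R :=
  directionWeight g i * if i = j ∧ k = l then 1 else 0

/-- The crossings of strands of different families are either deleted or identified with a crossing
of the two circles. -/
def linkCrossing (g : R) (i j : LeftColour) (k l : RightColour) : R :=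
  directionWeight g i * ((if i = j ∧ k = l then 1 else 0) +
    if ∃ m, LeftJump m i j ∧ RightJump m k l then 1 else 0)

/-- No two crossings are adjacent on both circles. -/
theorem not_jump_jump {m n : Fin 11} {i j i' : LeftColour} {k l k' : RightColour}
    (h₁ : LeftJump m i j) (h₂ : RightJump m k l) (h₁' : LeftJump n j i')
    (h₂' : RightJump n l k') : False := by
  have key : ∀ m n : Fin 11, (n = m + 1 ∨ n = m - 1) →
      ¬ (position n = position m ∨ position n = position m + 1 ∨ position n = position m - 1) := by
    decide
  refine key m n ?_ (h₂.comp h₂')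
  have := (h₁.comp h₁').2.2
  split_ifs at this
  · exact .inl this
  · exact .inr this

/-- Two successive crossings of the same two strands cancel: the two terms with one identified
crossing are equal, and the term with two identified crossings vanishes by `not_jump_jump`. -/
theorem linkCrossing_isMixedTensor [CharP R 2] {g : R} (hg : g * g = 1) :
    IsMixedTensor g turn id (linkCrossing g) where
  scalar := hg
  left_involutive := turn_involutive
  right_involutive _ := rfl
  flip_left i j k l := by
    have h1 : turn j = turn i ↔ i = j := by rw [turn_involutive.injective.eq_iff, eq_comm]
    unfold linkCrossing
    simp only [h1, LeftJump.turn_iff]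
    by_cases h : i.2 = j.2
    · cases hi : i.2
      · rw [hi] at h
        simp only [directionWeight, hi, turn, ← h]
        simp [← mul_assoc, hg]
      · rw [hi] at h
        simp [directionWeight, hi, turn, ← h]
    · have h2 : i ≠ j := fun h' => h (by rw [h'])
      have h3 : ¬ ∃ m, LeftJump m i j ∧ RightJump m k l := fun ⟨m, hm, _⟩ => h hm.snd_eq
      simp [h2, h3]
  flip_right i j k l := by
    simp only [linkCrossing, id, RightJump.symm_iff, eq_comm (a := k)]
  parallel i i' k k' := by
    have key : ∀ x y, linkCrossing g i x k y * linkCrossing g x i' y k' =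
        (if i = x ∧ k = y then (if x = i' ∧ y = k' then 1 else 0) else 0) +
        (if i = x ∧ k = y then (if ∃ m, LeftJump m x i' ∧ RightJump m y k' then 1 else 0) else 0) +
        (if x = i' ∧ y = k' then (if ∃ m, LeftJump m i x ∧ RightJump m k y then 1 else 0) else 0)
        := by
      intro x y
      by_cases h : i.2 = x.2
      · have h1 : directionWeight g i * directionWeight g x = 1 := by
          unfold directionWeight
          rw [h]
          split_ifs <;> simp [hg]
        have h2 : (if ∃ m, LeftJump m i x ∧ RightJump m k y then (1 : R) else 0) *
            (if ∃ m, LeftJump m x i' ∧ RightJump m y k' then 1 else 0) = 0 := by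
          split_ifs with h3 h4 <;> simp
          obtain ⟨m, hm, hm'⟩ := h3
          obtain ⟨n, hn, hn'⟩ := h4
          exact (not_jump_jump hm hm' hn hn').elim
        unfold linkCrossing
        rw [mul_mul_mul_comm, h1, one_mul, add_mul, mul_add, mul_add, h2]
        rw [add_zero]
        congr 1
        · split_ifs <;> simp
        · split_ifs <;> simp
      · have h2 : i ≠ x := fun h' => h (by rw [h'])
        have h3 : ¬ ∃ m, LeftJump m i x ∧ RightJump m k y := fun ⟨m, hm, _⟩ => h hm.snd_eq
        simp [linkCrossing, h2, h3]
    simp only [key, Finset.sum_add_distrib, ite_and]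
    simp [Finset.sum_ite_irrel]
    rw [add_assoc, CharTwo.add_self_eq_zero, add_zero]

/-- The tensor of the invariant. -/
def linkTensor (z g : R) :
    LeftColour ⊕ RightColour → LeftColour ⊕ RightColour →
      LeftColour ⊕ RightColour → LeftColour ⊕ RightColour → R :=
  tensor z turn id (linkCrossing g)

/-- The part of the tensor of the invariant in which no crossing is identified with a crossing of
the two circles. -/
def trivialTensor (z g : R) :
    LeftColour ⊕ RightColour → LeftColour ⊕ RightColour →
      LeftColour ⊕ RightColour → LeftColour ⊕ RightColour → R :=
  tensor z turn id (deletedCrossing g)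

theorem linkTensor_isInvariantTensor [CharP R 2] {z g : R} (hz : z * z = 0) (hg : g * g = 1) :
    IsInvariantTensor (linkTensor z g) := by
  have h2 : (2 : R) = 0 := CharTwo.two_eq_zero
  refine tensor_isInvariantTensor hz (linkCrossing_isMixedTensor hg) ?_ ?_
  · simp
    linear_combination 12 * h2
  · simp
    linear_combination 6 * h2

/-- A free involution of the colours that preserves the directions. -/
def recolour : LeftColour ⊕ RightColour → LeftColour ⊕ RightColour :=
  Sum.map (fun i => (i.1.rev, i.2)) Fin.rev

theorem recolour_involutive : Function.Involutive recolour := by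
  rintro (⟨i, a⟩ | i) <;> simp [recolour]

theorem recolour_ne (i : LeftColour ⊕ RightColour) : recolour i ≠ i := by
  have h : ∀ i : Fin 12, i.rev ≠ i := by decide
  rcases i with ⟨i, a⟩ | i <;> simp [recolour, h]

theorem trivialTensor_recolour (z g : R) (i j k l : LeftColour ⊕ RightColour) :
    trivialTensor z g (recolour i) (recolour j) (recolour k) (recolour l)
      = trivialTensor z g i j k l := by
  rcases i with ⟨i, a⟩ | i <;> rcases j with ⟨j, b⟩ | j <;> rcases k with ⟨k, c⟩ | k <;>
    rcases l with ⟨l, d⟩ | l <;>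
    simp [recolour, trivialTensor, tensor, bracket, delta, turn, deletedCrossing, directionWeight]

theorem sum_paths_recolour {C : Type*} [Fintype C] [DecidableEq C] {ρ : C → C}
    (hρ : ρ.Involutive) (w : List ℕ) (i j : C) (F : List (ℕ × C × C) → R) :
    ∑ s ∈ paths w (ρ i) (ρ j), F s
      = ∑ s ∈ paths w i j, F (s.map (Prod.map id (Prod.map ρ ρ))) := by
  induction w generalizing i F with
  | nil => simp [sum_paths_nil, hρ.injective.eq_iff]
  | cons c w ih =>
    simp only [sum_paths_cons]
    rw [← hρ.bijective.sum_comp]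
    simp [ih]

/-- A state sum vanishes if the tensor is preserved by a free involution of the colours. -/
theorem stateSum_eq_zero [CharP R 2] {C : Type*} [Fintype C] [DecidableEq C] {ρ : C → C}
    (hρ : ρ.Involutive) (hρ' : ∀ i, ρ i ≠ i) {U : C → C → C → C → R}
    (hU : ∀ i j k l, U (ρ i) (ρ j) (ρ k) (ρ l) = U i j k l) (w : List ℕ) : stateSum U w = 0 := by
  have hw : ∀ s, weight U (s.map (Prod.map id (Prod.map ρ ρ))) = weight U s := by
    intro s
    unfold weight
    have h1 : (s.map (Prod.map id (Prod.map ρ ρ))).map Prod.fst = s.map Prod.fst := by simp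
    rw [h1]
    refine Finset.prod_congr rfl fun c _ => ?_
    have h2 : ((s.map (Prod.map id (Prod.map ρ ρ))).filter (·.1 = c)).map Prod.snd
        = ((s.filter (·.1 = c)).map Prod.snd).map (Prod.map ρ ρ) := by
      rw [List.filter_map, List.map_map, List.map_map]
      rfl
    rw [h2]
    generalize (s.filter (·.1 = c)).map Prod.snd = t
    match t with
    | [] => rfl
    | [_] => rfl
    | [p, q] => exact hU ..
    | _ :: _ :: _ :: _ => rfl
  unfold stateSum
  refine Finset.sum_involution (fun i _ => ρ i) ?_ ?_ ?_ ?_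
  · intro i _
    rw [sum_paths_recolour hρ]
    simp only [hw, CharTwo.add_self_eq_zero]
  · intro i _ _
    exact hρ' i
  · simp
  · intro i _
    exact hρ i

end LinkTensor

/-! ### The colourings that contribute to the invariant -/

section Contributions

/-- The colours of the strands. -/
abbrev Colour := LeftColour ⊕ RightColour

/-- The steps `p` and `q` pass the crossing `m` of the two circles, `p` along the first circle and
`q` along the second one. -/
def Passage (m : Fin 11) (p q : Colour × Colour) : Prop :=
  ∃ a b c d, p = (.inl a, .inl b) ∧ q = (.inr c, .inr d) ∧ LeftJump m a b ∧ RightJump m c d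

/-- The two ends of a chord are identified with the crossing `m` of the two circles. -/
def Identified (m : Fin 11) (p q : Colour × Colour) : Prop := Passage m p q ∨ Passage m q p

theorem Identified.label_unique {m n : Fin 11} {p q : Colour × Colour} (h : Identified m p q)
    (h' : Identified n p q) : m = n := by
  rcases h with ⟨a, b, c, d, rfl, rfl, h, -⟩ | ⟨a, b, c, d, rfl, rfl, h, -⟩ <;>
    rcases h' with ⟨a', b', c', d', h1, h2, h', -⟩ | ⟨a', b', c', d', h1, h2, h', -⟩ <;>
    simp at h1 h2
  · obtain ⟨rfl, rfl⟩ := h1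
    exact h.label_unique h'
  · obtain ⟨rfl, rfl⟩ := h1
    exact h.label_unique h'

/-- A signed indicator of the arc `m` of the first circle. -/
def potential (m : Fin 11) : Colour → ℤ
  | .inl i => if i.1 = m.castSucc then (if i.2 then 1 else -1) else 0
  | .inr _ => 0

theorem potential_turn (m : Fin 11) (i : LeftColour) :
    potential m (.inl (turn i)) = - potential m (.inl i) := by
  obtain ⟨i, a⟩ := i
  cases a <;> simp [potential, turn, apply_ite]

theorem LeftJump.potential {m n : Fin 11} {i j : LeftColour} (h : LeftJump n i j) :
    potential m (.inl j) - potential m (.inl i)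
      = (if n = m - 1 then 1 else 0) - (if n = m then 1 else 0) := by
  have h1 : n + 1 = m ↔ n = m - 1 := eq_sub_iff_add_eq.symm
  rcases h with ⟨rfl, rfl⟩ | ⟨rfl, rfl⟩ <;> simp [FreeKnots.potential, h1]
  split_ifs <;> simp

variable {R : Type*} [CommRing R] {z g : R}

theorem exists_jump_iff_identified {i j : LeftColour} {k l : RightColour} :
    (∃ m, LeftJump m i j ∧ RightJump m k l) ↔
      ∃ m, Identified m (.inl i, .inl j) (.inr k, .inr l) := by
  constructor
  · rintro ⟨m, h⟩
    exact ⟨m, .inl ⟨i, j, k, l, rfl, rfl, h⟩⟩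
  · rintro ⟨m, ⟨a, b, c, d, h1, h2, h⟩ | ⟨a, b, c, d, h1, h2, h⟩⟩ <;>
      simp only [Prod.mk.injEq, Sum.inl.injEq, Sum.inr.injEq, reduceCtorEq, and_false] at h1 h2
    obtain ⟨rfl, rfl⟩ := h1
    obtain ⟨rfl, rfl⟩ := h2
    exact ⟨m, h⟩

theorem identified_comm {m : Fin 11} {p q : Colour × Colour} :
    Identified m p q ↔ Identified m q p := or_comm

theorem linkTensor_eq_trivialTensor {i j k l : Colour} (h : ∀ m, ¬ Identified m (i, j) (k, l)) :
    linkTensor z g i j k l = trivialTensor z g i j k l := by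
  have h' : ¬ ∃ m, Identified m (i, j) (k, l) := fun ⟨m, hm⟩ => h m hm
  rcases i with i | i <;> rcases j with j | j <;> rcases k with k | k <;> rcases l with l | l <;>
    try rfl
  · simp only [linkTensor, trivialTensor, tensor, linkCrossing, deletedCrossing,
      exists_jump_iff_identified, h', if_false, add_zero]
  · simp only [identified_comm (p := (.inr i, .inr j))] at h'
    simp only [linkTensor, trivialTensor, tensor, linkCrossing, deletedCrossing,
      exists_jump_iff_identified, h', if_false, add_zero]

theorem not_identified_of_trivialTensor_ne_zero {i j k l : Colour}
    (h : trivialTensor z g i j k l ≠ 0) (m : Fin 11) : ¬ Identified m (i, j) (k, l) := by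
  rintro (⟨a, b, c, d, h1, h2, h3, -⟩ | ⟨a, b, c, d, h1, h2, h3, -⟩) <;>
    simp only [Prod.mk.injEq] at h1 h2 <;>
    obtain ⟨rfl, rfl⟩ := h1 <;> obtain ⟨rfl, rfl⟩ := h2 <;>
    simp [trivialTensor, tensor, deletedCrossing, h3.ne] at h

/-- Conservation law: a crossing changes the total potential of the arc `m` only if it is identified
with one of the two crossings at the ends of this arc. -/
theorem potential_balance (m : Fin 11) {i j k l : Colour} (h : linkTensor z g i j k l ≠ 0) :
    open scoped Classical in
    (potential m j - potential m i) + (potential m l - potential m k) =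
      (if Identified (m - 1) (i, j) (k, l) then 1 else 0)
        - (if Identified m (i, j) (k, l) then 1 else 0) := by
  classical
  have mixed : ∀ {i j : LeftColour} {k l : RightColour}, linkCrossing g i j k l ≠ 0 →
      potential m (.inl j) - potential m (.inl i) =
      (if Identified (m - 1) (.inl i, .inl j) (.inr k, .inr l) then 1 else 0)
        - (if Identified m (.inl i, .inl j) (.inr k, .inr l) then 1 else 0) := by
    intro i j k l h
    by_cases hn : ∃ n, LeftJump n i j ∧ RightJump n k l
    · obtain ⟨n, hn⟩ := hn
      have hn' : Identified n (.inl i, .inl j) (.inr k, .inr l) :=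
        .inl ⟨i, j, k, l, rfl, rfl, hn⟩
      have key : ∀ n', Identified n' (.inl i, .inl j) (.inr k, .inr l) ↔ n = n' :=
        fun n' => ⟨fun h => hn'.label_unique h, fun h => h ▸ hn'⟩
      rw [hn.1.potential]
      simp only [key]
    · have hij : i = j := by
        by_contra hij
        simp [linkCrossing, hn, hij] at h
      rw [exists_jump_iff_identified, not_exists] at hn
      subst hij
      simp only [hn, if_false, sub_self]
  rcases i with i | i <;> rcases j with j | j <;> rcases k with k | k <;> rcases l with l | l <;>
    try exact absurd rfl h
  · have h0 : ∀ n, ¬ Identified n ((Sum.inl i, Sum.inl j) : Colour × Colour)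
      (Sum.inl k, Sum.inl l) := by simp [Identified, Passage]
    simp only [h0, if_false]
    by_cases h1 : i = l ∧ j = k
    · rw [h1.1, h1.2]
      ring
    · by_cases h2 : k = turn i ∧ l = turn j
      · rw [h2.1, h2.2, potential_turn, potential_turn]
        ring
      · refine absurd ?_ h
        simp only [linkTensor, tensor, bracket, delta]
        simp only [not_and_or] at h1 h2
        rcases h1 with h1 | h1 <;> rcases h2 with h2 | h2 <;> simp [h1, h2]
  · rw [mixed h]
    simp [potential]
  · have h0 : ∀ n, ¬ Identified n ((Sum.inl i, Sum.inr j) : Colour × Colour)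
      (Sum.inr k, Sum.inl l) := by simp [Identified, Passage]
    by_cases h1 : i = l
    · subst h1
      simp only [h0, if_false, potential]
      ring
    · simp [linkTensor, tensor, delta, h1] at h
  · have h0 : ∀ n, ¬ Identified n ((Sum.inr i, Sum.inl j) : Colour × Colour)
      (Sum.inl k, Sum.inr l) := by simp [Identified, Passage]
    by_cases h1 : j = k
    · subst h1
      simp only [h0, if_false, potential]
      ring
    · simp [linkTensor, tensor, delta, h1] at h
  · simp only [identified_comm (p := (.inr i, .inr j))]
    rw [← mixed h]
    simp [potential]
  · simp [potential, Identified, Passage]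

theorem linkTensor_switch {i j k l : Colour} (h : linkTensor z g i j k l ≠ 0)
    (hij : i.isLeft ≠ j.isLeft ∨ k.isLeft ≠ l.isLeft) :
    ∃ a b, (i = .inl a ∧ j = .inr b ∧ k = .inr b ∧ l = .inl a) ∨
      (i = .inr b ∧ j = .inl a ∧ k = .inl a ∧ l = .inr b) := by
  rcases i with i | i <;> rcases j with j | j <;> rcases k with k | k <;> rcases l with l | l <;>
    first
    | exact absurd rfl h
    | (simp at hij; done)
    | skip
  · simp only [linkTensor, tensor, delta] at h
    refine ⟨i, j, .inl ⟨rfl, rfl, ?_⟩⟩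
    by_cases h1 : i = l <;> by_cases h2 : j = k <;> simp_all
  · simp only [linkTensor, tensor, delta] at h
    refine ⟨j, i, .inr ⟨rfl, rfl, ?_⟩⟩
    by_cases h1 : i = l <;> by_cases h2 : j = k <;> simp_all

/-! #### Closed colourings -/

section Paths

variable {C : Type*} [Fintype C] [DecidableEq C]

theorem mem_paths_nil {i j : C} {s : List (ℕ × C × C)} :
    s ∈ paths [] i j ↔ i = j ∧ s = [] := by
  unfold paths
  split_ifs with h <;> simp [h]

theorem mem_paths_cons {c : ℕ} {w : List ℕ} {i j : C} {s : List (ℕ × C × C)} :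
    s ∈ paths (c :: w) i j ↔ ∃ k, ∃ t ∈ paths w k j, s = (c, i, k) :: t := by
  simp [paths, eq_comm]

theorem mem_paths_append {w v : List ℕ} {i j : C} {s : List (ℕ × C × C)} :
    s ∈ paths (w ++ v) i j ↔ ∃ k, ∃ t ∈ paths w i k, ∃ u ∈ paths v k j, s = t ++ u := by
  induction w generalizing i s with
  | nil => simp [mem_paths_nil]
  | cons c w ih =>
    simp only [List.cons_append, mem_paths_cons, ih]
    constructor
    · rintro ⟨k, _, ⟨l, t, ht, u, hu, rfl⟩, rfl⟩
      exact ⟨l, _, ⟨k, t, ht, rfl⟩, u, hu, rfl⟩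
    · rintro ⟨l, _, ⟨k, t, ht, rfl⟩, u, hu, rfl⟩
      exact ⟨k, _, ⟨l, t, ht, u, hu, rfl⟩, rfl⟩

/-- A closed colouring can be read from another base point. -/
theorem exists_rotate_mem_paths {w : List ℕ} {i : C} {s : List (ℕ × C × C)}
    (hs : s ∈ paths w i i) (n : ℕ) : ∃ k, s.rotate n ∈ paths (w.rotate n) k k := by
  induction n generalizing w i s with
  | zero => exact ⟨i, by simpa using hs⟩
  | succ n ih =>
    cases w with
    | nil =>
      obtain ⟨-, rfl⟩ := mem_paths_nil.mp hs
      exact ⟨i, by simpa using hs⟩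
    | cons c w =>
      obtain ⟨k, t, ht, rfl⟩ := mem_paths_cons.mp hs
      simp only [List.rotate_cons_succ]
      exact ih (mem_paths_append.mpr ⟨i, t, ht, [(c, i, k)],
        mem_paths_cons.mpr ⟨k, [], mem_paths_nil.mpr ⟨rfl, rfl⟩, rfl⟩, rfl⟩)

theorem exists_perm_mem_paths_of_isRotated {w w' : List ℕ} (h : w ~r w') {i : C}
    {s : List (ℕ × C × C)} (hs : s ∈ paths w i i) :
    ∃ k, ∃ s' ∈ paths w' k k, s.Perm s' := by
  obtain ⟨n, rfl⟩ := h
  obtain ⟨k, hk⟩ := exists_rotate_mem_paths hs n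
  exact ⟨k, _, hk, (List.rotate_perm s n).symm⟩

theorem sum_potential_of_mem_paths (φ : C → ℤ) {w : List ℕ} {i j : C} {s : List (ℕ × C × C)}
    (hs : s ∈ paths w i j) : (s.map fun t => φ t.2.2 - φ t.2.1).sum = φ j - φ i := by
  induction w generalizing i s with
  | nil => obtain ⟨rfl, rfl⟩ := mem_paths_nil.mp hs; simp
  | cons c w ih =>
    obtain ⟨k, t, ht, rfl⟩ := mem_paths_cons.mp hs
    rw [List.map_cons, List.sum_cons, ih ht]
    ring

theorem sum_map_eq_sum_letters {α : Type*} (f : ℕ × α → ℤ) (s : List (ℕ × α)) {A : Finset ℕ}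
    (hA : ∀ t ∈ s, t.1 ∈ A) :
    (s.map f).sum = ∑ c ∈ A, ((s.filter (·.1 = c)).map f).sum := by
  induction s with
  | nil => simp
  | cons t s ih =>
    have h : ∀ c, (((t :: s).filter (·.1 = c)).map f).sum
        = (if t.1 = c then f t else 0) + ((s.filter (·.1 = c)).map f).sum := by
      intro c
      by_cases hc : t.1 = c <;> simp [hc]
    simp only [h, Finset.sum_add_distrib, List.map_cons, List.sum_cons]
    rw [ih fun t ht => hA t (List.mem_cons_of_mem _ ht)]
    simp [hA t]

/-- A function of the colour that is preserved by every step is constant along a colouring. -/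
theorem constant_of_mem_paths {α : Type*} (φ : C → α) {w : List ℕ} {i j : C}
    {s : List (ℕ × C × C)} (hs : s ∈ paths w i j) (h : ∀ t ∈ s, φ t.2.1 = φ t.2.2) :
    φ i = φ j ∧ ∀ t ∈ s, φ t.2.1 = φ i := by
  induction w generalizing i s with
  | nil => obtain ⟨rfl, rfl⟩ := mem_paths_nil.mp hs; simp
  | cons c w ih =>
    obtain ⟨k, t, ht, rfl⟩ := mem_paths_cons.mp hs
    have h1 := ih ht fun t ht => h t (List.mem_cons_of_mem _ ht)
    have h2 := h _ List.mem_cons_self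
    dsimp only at h2
    rw [h2]
    refine ⟨h1.1, fun t ht => ?_⟩
    rcases List.mem_cons.mp ht with rfl | ht
    · exact h2
    · exact h1.2 t ht

/-- Consecutive steps of a closed colouring. -/
theorem exists_steps_of_isRotated {w u : List ℕ} {c d : ℕ} (h : w ~r c :: d :: u) {i : C}
    {s : List (ℕ × C × C)} (hs : s ∈ paths w i i) :
    ∃ p q r, (c, p, q) ∈ s ∧ (d, q, r) ∈ s := by
  obtain ⟨k, s', hs', hp⟩ := exists_perm_mem_paths_of_isRotated h hs
  obtain ⟨l, t, ht, rfl⟩ := mem_paths_cons.mp hs'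
  obtain ⟨m, t', -, rfl⟩ := mem_paths_cons.mp ht
  exact ⟨k, l, m, by simp [hp.mem_iff], by simp [hp.mem_iff]⟩

theorem eq_of_mem_paths_of_nodup {w : List ℕ} (hw : w.Nodup) {i j : C} {s : List (ℕ × C × C)}
    (hs : s ∈ paths w i j) {c : ℕ} {x y : C × C} (hx : (c, x) ∈ s) (hy : (c, y) ∈ s) : x = y := by
  rw [← map_fst_of_mem_paths hs] at hw
  have := List.inj_on_of_nodup_map hw hx hy rfl
  simpa using this

/-- A colouring is determined by its steps if they depend on the letters only. -/
theorem eq_map_of_mem_paths {w : List ℕ} {i j : C} {s : List (ℕ × C × C)} (hs : s ∈ paths w i j)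
    (f : ℕ → ℕ × C × C) (h : ∀ t ∈ s, t = f t.1) : s = w.map f := by
  rw [← map_fst_of_mem_paths hs, List.map_map]
  refine (List.map_id s).symm.trans (List.map_congr_left fun t ht => ?_)
  exact h t ht

theorem initial_unique_of_mem_paths {w : List ℕ} (hw : w ≠ []) {i j i' j' : C}
    {s : List (ℕ × C × C)} (hs : s ∈ paths w i j) (hs' : s ∈ paths w i' j') : i = i' := by
  cases w with
  | nil => exact absurd rfl hw
  | cons c w =>
    obtain ⟨k, t, -, rfl⟩ := mem_paths_cons.mp hs
    obtain ⟨k', t', -, h⟩ := mem_paths_cons.mp hs'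
    simp at h
    exact h.1.1

end Paths

/-- The shape of the colourings that contribute to the invariant: the strand changes the family of
colours at the chord `d` only, and any other chord `c` is identified with the crossing `label c` of
the two circles. -/
structure IsContribution (w : List ℕ) (d : ℕ) (label : ℕ → Fin 11)
    (s : List (ℕ × Colour × Colour)) : Prop where
  step : ∀ c ∈ w, c ≠ d → ∀ p q, (c, p, q) ∈ s →
    (∃ i j, p = .inl i ∧ q = .inl j ∧ LeftJump (label c) i j) ∨
      ∃ k l, p = .inr k ∧ q = .inr l ∧ RightJump (label c) k l
  exists_left : ∀ c ∈ w, c ≠ d → ∃ i j, (c, .inl i, .inl j) ∈ s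
  exists_right : ∀ c ∈ w, c ≠ d → ∃ k l, (c, .inr k, .inr l) ∈ s
  switch : ∃ i k, ∀ p q, (d, p, q) ∈ s →
    (p = .inl i ∧ q = .inr k) ∨ (p = .inr k ∧ q = .inl i)

theorem IsContribution.of_perm {w w' : List ℕ} {d : ℕ} {label : ℕ → Fin 11}
    {s s' : List (ℕ × Colour × Colour)} (h : IsContribution w d label s)
    (hw : ∀ c, c ∈ w' ↔ c ∈ w) (hs : s.Perm s') : IsContribution w' d label s' where
  step := by simpa only [hw, ← hs.mem_iff] using h.step
  exists_left := by simpa only [hw, ← hs.mem_iff] using h.exists_left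
  exists_right := by simpa only [hw, ← hs.mem_iff] using h.exists_right
  switch := by simpa only [hw, ← hs.mem_iff] using h.switch

set_option maxHeartbeats 1000000 in
/-- In a diagram with twelve chords, a colouring that is counted with different weights by the two
tensors identifies some chord with a crossing of the two circles. By the conservation law, each of
the eleven crossings then occurs, and the remaining chord is the one at which the family changes. -/
theorem exists_isContribution {w : List ℕ} (hw : ∀ c ∈ w, w.count c = 2)
    (hcard : w.toFinset.card = 12) {i₀ : Colour} {s : List (ℕ × Colour × Colour)}
    (hs : s ∈ paths w i₀ i₀) (hne : weight (linkTensor z g) s ≠ weight (trivialTensor z g) s) :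
    ∃ d ∈ w, ∃ label, IsContribution w d label s := by
  classical
  have hsw := map_fst_of_mem_paths hs
  have hpair : ∀ c, ∃ p q, c ∈ w → (s.filter (·.1 = c)).map Prod.snd = [p, q] := by
    intro c
    by_cases hc : c ∈ w
    · have hlen : ((s.filter (·.1 = c)).map Prod.snd).length = 2 := by
        rw [List.length_map, ← hw c hc, ← hsw, List.count, List.countP_map,
          List.countP_eq_length_filter]
        congr 2
      obtain ⟨p, q, h⟩ := List.length_eq_two.mp hlen
      exact ⟨p, q, fun _ => h⟩
    · exact ⟨(i₀, i₀), (i₀, i₀), fun h => absurd h hc⟩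
  choose P Q hPQ using hpair
  have hmem : ∀ c ∈ w, ∀ p q, (c, p, q) ∈ s ↔ (p, q) = P c ∨ (p, q) = Q c := by
    intro c hc p q
    have h1 : (c, p, q) ∈ s ↔ (p, q) ∈ (s.filter (·.1 = c)).map Prod.snd := by
      simp
    rw [h1, hPQ c hc]
    simp
  have hweight : ∀ U : Colour → Colour → Colour → Colour → R,
      weight U s = ∏ c ∈ w.toFinset, U (P c).1 (P c).2 (Q c).1 (Q c).2 := by
    intro U
    unfold weight
    rw [hsw]
    refine Finset.prod_congr rfl fun c hc => ?_
    rw [hPQ c (List.mem_toFinset.mp hc)]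
    rfl
  -- no factor of a nonzero product vanishes
  have hfactor : ∀ U : Colour → Colour → Colour → Colour → R, weight U s ≠ 0 → ∀ c ∈ w,
      U (P c).1 (P c).2 (Q c).1 (Q c).2 ≠ 0 := by
    intro U hU c hc h0
    exact hU (by rw [hweight]; exact Finset.prod_eq_zero (List.mem_toFinset.mpr hc) h0)
  have hex : ∃ c ∈ w, ∃ m, Identified m (P c) (Q c) := by
    by_contra hcon
    push Not at hcon
    refine hne ?_
    rw [hweight, hweight]
    exact Finset.prod_congr rfl fun c hc =>
      linkTensor_eq_trivialTensor (hcon c (List.mem_toFinset.mp hc))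
  have hlink : ∀ c ∈ w, linkTensor z g (P c).1 (P c).2 (Q c).1 (Q c).2 ≠ 0 := by
    refine hfactor _ fun h0 => hne ?_
    have h1 : weight (trivialTensor z g) s ≠ 0 := fun h => hne (h0.trans h.symm)
    rw [hweight, hweight]
    exact Finset.prod_congr rfl fun c hc => linkTensor_eq_trivialTensor
      (not_identified_of_trivialTensor_ne_zero (hfactor _ h1 c (List.mem_toFinset.mp hc)))
  -- the number of chords identified with the crossing `m` does not depend on `m`
  let n : Fin 11 → ℤ := fun m => ∑ c ∈ w.toFinset, if Identified m (P c) (Q c) then 1 else 0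
  have hn : ∀ m, n (m - 1) = n m := by
    intro m
    have h1 := sum_potential_of_mem_paths (potential m) hs
    rw [sum_map_eq_sum_letters _ s (A := w.toFinset)] at h1
    · have h2 : ∀ c ∈ w.toFinset, ((s.filter (·.1 = c)).map
          fun t => potential m t.2.2 - potential m t.2.1).sum =
          (if Identified (m - 1) (P c) (Q c) then 1 else 0)
            - (if Identified m (P c) (Q c) then 1 else 0) := by
        intro c hc
        have hc := List.mem_toFinset.mp hc
        have h3 := potential_balance m (hlink c hc)
        have h4 : (s.filter (·.1 = c)).map (fun t => potential m t.2.2 - potential m t.2.1)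
            = ((s.filter (·.1 = c)).map Prod.snd).map
              fun t => potential m t.2 - potential m t.1 := by
          rw [List.map_map]; rfl
        rw [h4, hPQ c hc, ← h3]
        simp
      rw [Finset.sum_congr rfl h2, Finset.sum_sub_distrib, sub_self] at h1
      exact sub_eq_zero.mp h1
    · intro t ht
      rw [List.mem_toFinset, ← hsw]
      exact List.mem_map_of_mem ht
  have hn' : ∀ m, n m = n 0 := by
    have h1 : ∀ i : Fin 10, i.succ - 1 = i.castSucc := by decide
    refine Fin.induction rfl fun i ih => ?_
    rw [← hn, h1, ih]
  have hall : ∀ m, ∃ c ∈ w, Identified m (P c) (Q c) := by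
    obtain ⟨c₀, hc₀, m₀, hm₀⟩ := hex
    intro m
    by_contra hcon
    push Not at hcon
    have h0 : n m = 0 := Finset.sum_eq_zero fun c hc => if_neg (hcon c (List.mem_toFinset.mp hc))
    have h1 : n m = n m₀ := (hn' m).trans (hn' m₀).symm
    have h2 : n m₀ ≠ 0 := by
      refine (Finset.sum_pos' (fun c _ => ?_) ⟨c₀, List.mem_toFinset.mpr hc₀, ?_⟩).ne'
      · split_ifs <;> simp
      · simp [hm₀]
    exact h2 (h1 ▸ h0)
  choose e he he' using hall
  have hinj : e.Injective := fun m m' h => (he' m).label_unique (h ▸ he' m')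
  have hcard' : (w.toFinset \ Finset.univ.image e).card = 1 := by
    rw [Finset.card_sdiff_of_subset, hcard, Finset.card_image_of_injective _ hinj]
    · simp
    · intro c hc
      obtain ⟨m, -, rfl⟩ := Finset.mem_image.mp hc
      exact List.mem_toFinset.mpr (he m)
  obtain ⟨d, hd⟩ := Finset.card_eq_one.mp hcard'
  have hdw : d ∈ w := by
    have : d ∈ w.toFinset \ Finset.univ.image e := by simp [hd]
    exact List.mem_toFinset.mp (Finset.mem_sdiff.mp this).1
  have hlabel : ∀ c, ∃ m, c ∈ w → c ≠ d → Identified m (P c) (Q c) := by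
    intro c
    by_cases hc : c ∈ w ∧ c ≠ d
    · have h1 : c ∉ w.toFinset \ Finset.univ.image e := by simp [hd, hc.2]
      simp only [Finset.mem_sdiff, List.mem_toFinset, hc.1, true_and, not_not, Finset.mem_image,
        Finset.mem_univ] at h1
      obtain ⟨m, rfl⟩ := h1
      exact ⟨m, fun _ _ => he' m⟩
    · exact ⟨0, fun h h' => absurd ⟨h, h'⟩ hc⟩
  choose label hlabel using hlabel
  have hstep : ∀ c ∈ w, c ≠ d → ∀ p q, (c, p, q) ∈ s →
      (∃ i j, p = .inl i ∧ q = .inl j ∧ LeftJump (label c) i j) ∨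
        ∃ k l, p = .inr k ∧ q = .inr l ∧ RightJump (label c) k l := by
    intro c hc hcd p q hpq
    rw [hmem c hc] at hpq
    rcases hlabel c hc hcd with ⟨i, j, k, l, h1, h2, h3, h4⟩ | ⟨i, j, k, l, h2, h1, h3, h4⟩ <;>
      simp only [h1, h2, Prod.mk.injEq] at hpq <;>
      rcases hpq with ⟨rfl, rfl⟩ | ⟨rfl, rfl⟩ <;> simp [h3, h4]
  have hleft : ∀ c ∈ w, c ≠ d → ∃ i j, (c, .inl i, .inl j) ∈ s := by
    intro c hc hcd
    simp only [hmem c hc]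
    rcases hlabel c hc hcd with ⟨i, j, k, l, h1, h2, h3, h4⟩ | ⟨i, j, k, l, h2, h1, h3, h4⟩
    · exact ⟨i, j, .inl h1.symm⟩
    · exact ⟨i, j, .inr h2.symm⟩
  have hright : ∀ c ∈ w, c ≠ d → ∃ k l, (c, .inr k, .inr l) ∈ s := by
    intro c hc hcd
    simp only [hmem c hc]
    rcases hlabel c hc hcd with ⟨i, j, k, l, h1, h2, h3, h4⟩ | ⟨i, j, k, l, h2, h1, h3, h4⟩
    · exact ⟨k, l, .inr h2.symm⟩
    · exact ⟨k, l, .inl h1.symm⟩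
  refine ⟨d, hdw, label, hstep, hleft, hright, ?_⟩
  by_cases hsw' : (P d).1.isLeft ≠ (P d).2.isLeft ∨ (Q d).1.isLeft ≠ (Q d).2.isLeft
  · obtain ⟨i, k, h⟩ := linkTensor_switch (hlink d hdw) hsw'
    refine ⟨i, k, fun p q hpq => ?_⟩
    rw [hmem d hdw, Prod.ext_iff, Prod.ext_iff] at hpq
    rcases h with ⟨h1, h2, h3, h4⟩ | ⟨h1, h2, h3, h4⟩ <;> simp only [h1, h2, h3, h4] at hpq
    · exact hpq
    · exact hpq.symm
  · -- otherwise the family would never change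
    push Not at hsw'
    exfalso
    have h1 := (constant_of_mem_paths Sum.isLeft hs (by
      rintro ⟨c, p, q⟩ ht
      have hc : c ∈ w := hsw ▸ List.mem_map_of_mem ht
      by_cases hcd : c = d
      · subst hcd
        rcases (hmem c hc p q).mp ht with h | h <;> rw [Prod.ext_iff] at h <;>
          simp only at h ⊢ <;> rw [h.1, h.2]
        exacts [hsw'.1, hsw'.2]
      · rcases hstep c hc hcd p q ht with ⟨i, j, rfl, rfl, -⟩ | ⟨k, l, rfl, rfl, -⟩ <;> rfl)).2
    have hed : e 0 ≠ d := by
      rintro rfl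
      have : e 0 ∈ w.toFinset \ Finset.univ.image e := by rw [hd]; simp
      simp at this
    obtain ⟨i, j, hij⟩ := hleft _ (he 0) hed
    obtain ⟨k, l, hkl⟩ := hright _ (he 0) hed
    have := (h1 _ hij).trans (h1 _ hkl).symm
    simp at this

end Contributions

/-! ### Evaluation on the lifts of the link -/

section Evaluation

/-- In the cyclic word `w` the ends of the chords `c` and `d` alternate. -/
def Alternate (w : List ℕ) (c d : ℕ) : Prop := ∃ x y, w ~r c :: x ++ c :: y ∧ d ∈ x ∧ d ∈ y

theorem exists_isRotated_of_mem {w : List ℕ} {d : ℕ} (hd : w.count d = 2) :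
    ∃ x y, w ~r d :: x ++ d :: y := by
  obtain ⟨u, v, rfl⟩ := List.append_of_mem (List.count_pos_iff.mp (by omega : 0 < w.count d))
  simp only [List.count_append, List.count_cons_self] at hd
  obtain ⟨x, y, hxy⟩ := List.append_of_mem
    (List.count_pos_iff.mp (by rw [List.count_append]; omega : 0 < (v ++ u).count d))
  refine ⟨x, y, ?_⟩
  rw [List.cons_append, ← hxy]
  simpa using List.isRotated_append (l := u) (l' := d :: v)

/-- The chord at which a contributing colouring changes the family of colours is linked with all the
other chords. -/
theorem IsContribution.alternate {w : List ℕ} (hw : ∀ c ∈ w, w.count c = 2) {d : ℕ} (hd : d ∈ w)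
    {label : ℕ → Fin 11} {i : Colour} {s : List (ℕ × Colour × Colour)} (hs : s ∈ paths w i i)
    (h : IsContribution w d label s) {e : ℕ} (he : e ∈ w) (hed : e ≠ d) : Alternate w d e := by
  obtain ⟨x, y, hxy⟩ := exists_isRotated_of_mem (hw d hd)
  refine ⟨x, y, hxy, ?_⟩
  have hcount : (d :: x ++ d :: y).count d = 2 := by rw [← hxy.perm.count_eq, hw d hd]
  simp only [List.count_append, List.count_cons_self] at hcount
  have hdx : d ∉ x := List.count_eq_zero.mp (by omega)
  have hdy : d ∉ y := List.count_eq_zero.mp (by omega)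
  obtain ⟨k, s', hs', hp⟩ := exists_perm_mem_paths_of_isRotated hxy hs
  have h' := h.of_perm (w' := d :: x ++ d :: y) (fun c => hxy.perm.symm.mem_iff) hp
  rw [hxy.perm.mem_iff] at he
  clear hp hs hxy h
  rw [mem_paths_append] at hs'
  obtain ⟨l, t₀, ht₀, u₀, hu₀, rfl⟩ := hs'
  obtain ⟨k', t, ht, rfl⟩ := mem_paths_cons.mp ht₀
  obtain ⟨l', u, hu, rfl⟩ := mem_paths_cons.mp hu₀
  have hne : ∀ {v : List ℕ} {p q : Colour} {r : List (ℕ × Colour × Colour)}, d ∉ v →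
      (∀ c ∈ v, c ∈ d :: x ++ d :: y) → r ∈ paths v p q →
      (∀ a ∈ r, a ∈ (d, k, k') :: t ++ (d, l, l') :: u) → ∀ a ∈ r, a.2.1.isLeft = a.2.2.isLeft := by
    rintro v p q r hdv hv hr hsub ⟨c, b, b'⟩ ha
    have hc : c ∈ v := map_fst_of_mem_paths hr ▸ List.mem_map_of_mem ha
    rcases h'.step c (hv c hc) (fun h => hdv (h ▸ hc)) b b' (hsub _ ha) with
      ⟨i, j, rfl, rfl, -⟩ | ⟨i, j, rfl, rfl, -⟩ <;> rfl
  have ht' := constant_of_mem_paths Sum.isLeft ht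
    (hne hdx (fun c hc => by simp [hc]) ht fun a ha => by simp [ha])
  have hu' := constant_of_mem_paths Sum.isLeft hu
    (hne hdy (fun c hc => by simp [hc]) hu fun a ha => by simp [ha])
  have hkl : k'.isLeft ≠ l'.isLeft := by
    rw [ht'.1]
    obtain ⟨a, b, hab⟩ := h'.switch
    rcases hab l l' (by simp) with ⟨rfl, rfl⟩ | ⟨rfl, rfl⟩ <;> simp
  obtain ⟨i, j, hij⟩ := h'.exists_left e he hed
  obtain ⟨i', j', hij'⟩ := h'.exists_right e he hed
  have hmem : ∀ {p q}, (e, p, q) ∈ (d, k, k') :: t ++ (d, l, l') :: u →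
      (e ∈ x ∧ p.isLeft = k'.isLeft) ∨ (e ∈ y ∧ p.isLeft = l'.isLeft) := by
    intro p q hpq
    simp only [List.mem_append, List.mem_cons, Prod.mk.injEq, hed, false_and, false_or] at hpq
    rcases hpq with hpq | hpq
    · exact .inl ⟨map_fst_of_mem_paths ht ▸ List.mem_map_of_mem hpq, ht'.2 _ hpq⟩
    · exact .inr ⟨map_fst_of_mem_paths hu ▸ List.mem_map_of_mem hpq, hu'.2 _ hpq⟩
  have h1 := hmem hij
  have h2 := hmem hij'
  simp only [Sum.isLeft_inl, Sum.isLeft_inr] at h1 h2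
  rcases h1 with ⟨h1, h3⟩ | ⟨h1, h3⟩ <;> rcases h2 with ⟨h2, h4⟩ | ⟨h2, h4⟩
  · simp [← h4] at h3
  · exact ⟨h1, h2⟩
  · exact ⟨h2, h1⟩
  · simp [← h4] at h3

/-! #### The labels of the chords -/

/-- The crossing at a position of the second circle. -/
def crossing : Fin 11 → Fin 11 := ![0, 8, 4, 1, 6, 10, 2, 9, 5, 3, 7]

/-- Equal or neighbouring positions. -/
def Near (p q : Fin 11) : Prop := q = p ∨ q = p + 1 ∨ q = p - 1

instance (p q : Fin 11) : Decidable (Near p q) := by unfold Near; infer_instance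

theorem Near.symm {p q : Fin 11} (h : Near p q) : Near q p := by
  rcases h with rfl | rfl | rfl <;> simp [Near]

theorem eq_affine {L : Fin 11 → Fin 11} {b : Bool}
    (h : ∀ m, L (m + 1) = if b then L m + 1 else L m - 1) (m : Fin 11) :
    L m = if b then L 0 + m else L 0 - m := by
  have h1 : ∀ i : Fin 10, i.succ = i.castSucc + 1 := by decide
  refine Fin.induction (by simp) (fun i ih => ?_) m
  rw [h1, h, ih]
  cases b
  · simp [sub_sub]
  · simp [add_assoc]

/-- The two circles have no common symmetry. -/
theorem labels_eq_id {L : Fin 11 → Fin 11} {b : Bool}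
    (h : ∀ m, L (m + 1) = if b then L m + 1 else L m - 1)
    (h' : ∀ p, Near (position (L (crossing p))) (position (L (crossing (p + 1))))) :
    b = true ∧ ∀ m, L m = m := by
  -- the labels are an affine function on the first circle, which leaves 22 cases
  have key : ∀ (b : Bool) (q : Fin 11), (∀ p, Near
      (position (if b then q + crossing p else q - crossing p))
      (position (if b then q + crossing (p + 1) else q - crossing (p + 1)))) →
      b = true ∧ q = 0 := by
    decide
  have h1 := eq_affine h
  obtain ⟨rfl, h0⟩ := key b (L 0) fun p => by rw [← h1, ← h1]; exact h' p
  exact ⟨rfl, fun m => by rw [h1, h0]; simp⟩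

/-- No symmetry exchanges the two circles. -/
theorem labels_not_exchanged {L : Fin 11 → Fin 11} {b : Bool}
    (h : ∀ p, L (crossing (p + 1)) = if b then L (crossing p) + 1 else L (crossing p) - 1)
    (h' : ∀ m, Near (position (L m)) (position (L (m + 1)))) : False := by
  have key : ∀ (b : Bool) (q : Fin 11), ¬ ∀ m, Near
      (position (if b then q + position m else q - position m))
      (position (if b then q + position (m + 1) else q - position (m + 1))) := by
    decide
  have h1 := eq_affine (L := fun p => L (crossing p)) h
  have h2 : ∀ m, crossing (position m) = m := by decide
  have h3 : ∀ m, L m = if b then L (crossing 0) + position m else L (crossing 0) - position m := by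
    intro m
    rw [← h1, h2]
  exact key b (L (crossing 0)) fun m => by rw [← h3, ← h3]; exact h' m

/-- A closed colouring by the first family of colours: the direction is constant, and the labels of
consecutive chords are consecutive on the first circle. -/
theorem exists_direction_of_leftJump {w : List ℕ} {p : Colour} {t : List (ℕ × Colour × Colour)}
    (ht : t ∈ paths w p p) {label : ℕ → Fin 11}
    (h : ∀ a ∈ t, ∃ i j, a.2 = (.inl i, .inl j) ∧ LeftJump (label a.1) i j) :
    ∃ β : Bool, (∀ e i j, (e, .inl i, .inl j) ∈ t → i.2 = β) ∧
      ∀ c d u, w ~r c :: d :: u → label d = if β then label c + 1 else label c - 1 := by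
  -- the value on the second family does not matter
  have h1 := constant_of_mem_paths (Sum.elim Prod.snd fun _ => true) ht (by
    rintro ⟨e, a⟩ ha
    obtain ⟨i, j, rfl, hij⟩ := h _ ha
    exact hij.snd_eq)
  refine ⟨_, fun e i j hij => h1.2 _ hij, fun c d u hcd => ?_⟩
  obtain ⟨q, r, s, hqr, hrs⟩ := exists_steps_of_isRotated hcd ht
  obtain ⟨i, j, hij, hij'⟩ := h _ hqr
  obtain ⟨j', k, hjk, hjk'⟩ := h _ hrs
  simp only [Prod.mk.injEq] at hij hjk
  obtain ⟨rfl, rfl⟩ := hij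
  obtain ⟨h2, rfl⟩ := hjk
  obtain rfl := Sum.inl_injective h2
  have h3 := h1.2 _ hrs
  simp only [Sum.elim_inl] at h3
  rw [← h3]
  exact (hij'.comp hjk').2.2

/-- A closed colouring by the second family of colours: the labels of consecutive chords are equal
or neighbours on the second circle. -/
theorem near_of_rightJump {w : List ℕ} {p : Colour} {t : List (ℕ × Colour × Colour)}
    (ht : t ∈ paths w p p) {label : ℕ → Fin 11}
    (h : ∀ a ∈ t, ∃ i j, a.2 = (.inr i, .inr j) ∧ RightJump (label a.1) i j)
    {c d : ℕ} {u : List ℕ} (hcd : w ~r c :: d :: u) :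
    Near (position (label c)) (position (label d)) := by
  obtain ⟨q, r, s, hqr, hrs⟩ := exists_steps_of_isRotated hcd ht
  obtain ⟨i, j, hij, hij'⟩ := h _ hqr
  obtain ⟨j', k, hjk, hjk'⟩ := h _ hrs
  simp only [Prod.mk.injEq] at hij hjk
  obtain ⟨rfl, rfl⟩ := hij
  obtain ⟨h2, rfl⟩ := hjk
  obtain rfl := Sum.inr_injective h2
  exact hij'.comp hjk'

/-- The first circle with one of its two orientations. -/
def leftWord (b : Bool) : List ℕ := if b then circleL1 else circleL1.reverse

/-- The second circle with one of its two orientations. -/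
def rightWord (o : Bool) : List ℕ := if o then circleL2 else circleL2.reverse

/-- The chord `e` passes the crossing with the same name along the first circle. The names that
occur are smaller than `11`, so the reduction modulo `11` does not matter. -/
def leftStep (b : Bool) (e : ℕ) : ℕ × Colour × Colour :=
  (e, if b then (.inl ((Fin.ofNat 11 e).castSucc, true), .inl ((Fin.ofNat 11 e + 1).castSucc, true))
    else (.inl ((Fin.ofNat 11 e + 1).castSucc, false), .inl ((Fin.ofNat 11 e).castSucc, false)))

/-- The chord `e` passes the crossing with the same name along the second circle. -/
def rightStep (o : Bool) (e : ℕ) : ℕ × Colour × Colour :=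
  (e, if o then (.inr (position (Fin.ofNat 11 e)).castSucc,
      .inr (position (Fin.ofNat 11 e) + 1).castSucc)
    else (.inr (position (Fin.ofNat 11 e) + 1).castSucc,
      .inr (position (Fin.ofNat 11 e)).castSucc))

theorem isRotated_cons_cons_of_take {w : List ℕ} {n c d : ℕ} (h : (w.rotate n).take 2 = [c, d]) :
    ∃ u, w ~r c :: d :: u :=
  ⟨(w.rotate n).drop 2, n, by
    rw [← List.take_append_drop 2 (w.rotate n), h, List.drop_append]; simp⟩

theorem leftWord_consecutive (b : Bool) (m : Fin 11) : ∃ u, leftWord b ~r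
    ((if b then m else m + 1 : Fin 11) : ℕ) :: ((if b then m + 1 else m : Fin 11) : ℕ) :: u := by
  have h : ∀ (b : Bool) (m : Fin 11), ∃ n : Fin 11, ((leftWord b).rotate n).take 2 =
      [((if b then m else m + 1 : Fin 11) : ℕ), ((if b then m + 1 else m : Fin 11) : ℕ)] := by
    decide
  obtain ⟨n, hn⟩ := h b m
  exact isRotated_cons_cons_of_take hn

theorem rightWord_consecutive (o : Bool) (p : Fin 11) : ∃ u, rightWord o ~r
    (crossing (if o then p else p + 1) : ℕ) :: (crossing (if o then p + 1 else p) : ℕ) :: u := by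
  have h : ∀ (o : Bool) (p : Fin 11), ∃ n : Fin 11, ((rightWord o).rotate n).take 2 =
      [(crossing (if o then p else p + 1) : ℕ), (crossing (if o then p + 1 else p) : ℕ)] := by
    decide
  obtain ⟨n, hn⟩ := h o p
  exact isRotated_cons_cons_of_take hn

theorem leftWord_perm (b : Bool) : (leftWord b).Perm circleL1 := by
  revert b; decide

theorem rightWord_perm (o : Bool) : (rightWord o).Perm circleL1 := by
  revert o; decide

theorem mem_circleL1 {e : ℕ} : e ∈ circleL1 ↔ e < 11 := by
  rw [show circleL1 = List.range 11 by decide, List.mem_range]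

/-- The colours at the crossing shared by two consecutive passages along the second circle. -/
theorem RightJump.eq_of_position_eq {m n : Fin 11} {i j k : RightColour} (h : RightJump m i j)
    (h' : RightJump n j k) (hmn : position n = position m + 1) :
    (i = (position m).castSucc ∧ j = (position m + 1).castSucc) ∧
      k = (position n + 1).castSucc := by
  have h1 : ∀ p : Fin 11, p + 1 + 1 ≠ p ∧ p + 1 ≠ p ∧ p ≠ p + 1 ∧ p ≠ p + 1 + 1 := by decide
  have h2 := h1 (position m)
  rcases h with ⟨rfl, rfl⟩ | ⟨rfl, rfl⟩ <;> rcases h' with ⟨h3, rfl⟩ | ⟨h3, rfl⟩ <;>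
    simp_all [Fin.castSucc_inj]

/-- Steps that depend on the letters only and match each other form a colouring. -/
theorem map_mem_paths {f : ℕ → ℕ × Colour × Colour} (hf : ∀ e, (f e).1 = e) {c d : ℕ}
    {w : List ℕ} (h : List.IsChain (fun e e' => (f e).2.2 = (f e').2.1) (c :: w))
    (hd : (c :: w).getLast? = some d) {i j : Colour} (hi : (f c).2.1 = i) (hj : (f d).2.2 = j) :
    (c :: w).map f ∈ paths (c :: w) i j := by
  induction w generalizing c i with
  | nil =>
    obtain rfl : c = d := by simpa using hd
    refine mem_paths_cons.mpr ⟨j, [], mem_paths_nil.mpr ⟨rfl, rfl⟩, ?_⟩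
    simp [Prod.ext_iff, hf, hi, hj]
  | cons e w ih =>
    rw [List.isChain_cons_cons] at h
    refine mem_paths_cons.mpr ⟨(f c).2.2, (e :: w).map f, ih h.2 (by simpa using hd) h.1.symm, ?_⟩
    simp [Prod.ext_iff, hf, hi]

theorem exists_closed_map {f : ℕ → ℕ × Colour × Colour} (hf : ∀ e, (f e).1 = e) (c d : ℕ)
    {v w : List ℕ} (hw : w = c :: v)
    (h : List.IsChain (fun e e' => (f e).2.2 = (f e').2.1) w) (hd : w.getLast? = some d)
    (hcd : (f d).2.2 = (f c).2.1) : ∃ x, w.map f ∈ paths w x x := by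
  subst hw
  exact ⟨_, map_mem_paths hf h hd rfl hcd⟩

theorem exists_closed_of_isRotated {f : ℕ → ℕ × Colour × Colour} {X w : List ℕ} (hX : X ~r w)
    {x : Colour} (h : w.map f ∈ paths w x x) : ∃ x, X.map f ∈ paths X x x := by
  obtain ⟨n, rfl⟩ := hX.symm
  obtain ⟨k, hk⟩ := exists_rotate_mem_paths h n
  exact ⟨k, by rwa [List.map_rotate]⟩

theorem exists_closed_leftStep {X : List ℕ} {b : Bool} (hX : X ~r leftWord b) :
    ∃ x₀, X.map (leftStep b) ∈ paths X (.inl x₀) (.inl x₀) := by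
  have h : ∃ x, (leftWord b).map (leftStep b) ∈ paths (leftWord b) x x := by
    cases b
    · exact exists_closed_map (fun _ => rfl) 10 0 rfl (by decide) (by decide) (by decide)
    · exact exists_closed_map (fun _ => rfl) 0 10 rfl (by decide) (by decide) (by decide)
  obtain ⟨x, hx⟩ := h
  obtain ⟨x₀, hx₀⟩ := exists_closed_of_isRotated hX hx
  have h0 : 0 ∈ X := by rw [hX.perm.mem_iff, (leftWord_perm b).mem_iff]; decide
  have h1 := (constant_of_mem_paths Sum.isLeft hx₀ (by
    rintro _ ha
    obtain ⟨e, -, rfl⟩ := List.mem_map.mp ha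
    cases b <;> rfl)).2 _ (List.mem_map_of_mem h0)
  obtain ⟨y, rfl⟩ : ∃ y, x₀ = .inl y := by
    rw [← Sum.isLeft_iff, ← h1]
    cases b <;> rfl
  exact ⟨y, hx₀⟩

theorem exists_closed_rightStep {Y : List ℕ} {o : Bool} (hY : Y ~r rightWord o) :
    ∃ y₀, Y.map (rightStep o) ∈ paths Y (.inr y₀) (.inr y₀) := by
  have h : ∃ x, (rightWord o).map (rightStep o) ∈ paths (rightWord o) x x := by
    cases o
    · exact exists_closed_map (fun _ => rfl) 7 0 rfl (by decide) (by decide) (by decide)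
    · exact exists_closed_map (fun _ => rfl) 0 7 rfl (by decide) (by decide) (by decide)
  obtain ⟨x, hx⟩ := h
  obtain ⟨x₀, hx₀⟩ := exists_closed_of_isRotated hY hx
  have h0 : 0 ∈ Y := by rw [hY.perm.mem_iff, (rightWord_perm o).mem_iff]; decide
  have h1 := (constant_of_mem_paths Sum.isLeft hx₀ (by
    rintro _ ha
    obtain ⟨e, -, rfl⟩ := List.mem_map.mp ha
    cases o <;> rfl)).2 _ (List.mem_map_of_mem h0)
  obtain ⟨y, rfl⟩ : ∃ y, x₀ = .inr y := by
    rw [← Sum.isRight_iff, ← Sum.isLeft_eq_false, ← h1]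
    cases o <;> rfl
  exact ⟨y, hx₀⟩

/-- If the labels are the names of the crossings, a colouring of the first circle by the first
family with the direction of this circle is the tautological one. -/
theorem eq_map_leftStep {X : List ℕ} {b : Bool} (hX : X ~r leftWord b) {p q : Colour}
    {t : List (ℕ × Colour × Colour)} (ht : t ∈ paths X p q) {label : ℕ → Fin 11}
    (h : ∀ a ∈ t, ∃ i j, a.2 = (.inl i, .inl j) ∧ LeftJump (label a.1) i j)
    (hb : ∀ e i j, (e, .inl i, .inl j) ∈ t → i.2 = b) (hlabel : ∀ m : Fin 11, label m = m) :
    t = X.map (leftStep b) := by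
  refine eq_map_of_mem_paths ht _ ?_
  rintro ⟨e, a⟩ ha
  obtain ⟨i, j, rfl, hij⟩ := h _ ha
  have h1 := hb e i j ha
  have he : e ∈ X := map_fst_of_mem_paths ht ▸ List.mem_map_of_mem ha
  rw [hX.perm.mem_iff, (leftWord_perm b).mem_iff, mem_circleL1] at he
  have h2 : label e = Fin.ofNat 11 e := by
    have := hlabel ⟨e, he⟩
    rw [show ((⟨e, he⟩ : Fin 11) : ℕ) = e from rfl] at this
    rw [this]
    ext
    simp [Nat.mod_eq_of_lt he]
  rw [h2] at hij
  rcases hij with ⟨rfl, rfl⟩ | ⟨rfl, rfl⟩ <;> subst h1 <;> rfl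

/-- If the labels are the names of the crossings, a colouring of the second circle by the second
family is the tautological one. -/
theorem eq_map_rightStep {Y : List ℕ} {o : Bool} (hY : Y ~r rightWord o) {p : Colour}
    {t : List (ℕ × Colour × Colour)} (ht : t ∈ paths Y p p) {label : ℕ → Fin 11}
    (h : ∀ a ∈ t, ∃ i j, a.2 = (.inr i, .inr j) ∧ RightJump (label a.1) i j)
    (hlabel : ∀ m : Fin 11, label m = m) : t = Y.map (rightStep o) := by
  have hnodup : Y.Nodup := by
    rw [hY.perm.nodup_iff, (rightWord_perm o).nodup_iff]; decide
  refine eq_map_of_mem_paths ht _ ?_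
  rintro ⟨e, a⟩ ha
  have he : e ∈ Y := map_fst_of_mem_paths ht ▸ List.mem_map_of_mem ha
  rw [hY.perm.mem_iff, (rightWord_perm o).mem_iff, mem_circleL1] at he
  obtain ⟨m, rfl⟩ : ∃ m : Fin 11, (m : ℕ) = e := ⟨⟨e, he⟩, rfl⟩
  have hm : crossing (position m) = m := by clear ha he; revert m; decide
  have hm' : position (crossing (position m + 1)) = position m + 1 := by
    clear ha he hm; revert m; decide
  obtain ⟨u, hu⟩ := rightWord_consecutive o (position m)
  obtain ⟨p, q, r, hp, hq⟩ := exists_steps_of_isRotated (hY.trans hu) ht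
  obtain ⟨i, j, hij, hij'⟩ := h _ hp
  obtain ⟨j', k, hjk, hjk'⟩ := h _ hq
  simp only [Prod.mk.injEq] at hij hjk
  obtain ⟨rfl, rfl⟩ := hij
  obtain ⟨h2, rfl⟩ := hjk
  obtain rfl := Sum.inr_injective h2
  simp only [hlabel] at hij' hjk'
  cases o
  · simp only [Bool.false_eq_true, if_false, hm] at hp hq hij' hjk'
    have h3 := (RightJump.symm_iff.mpr hjk').eq_of_position_eq (RightJump.symm_iff.mpr hij') hm'
    obtain rfl := eq_of_mem_paths_of_nodup hnodup ht ha hq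
    rw [h3.1.1, h3.1.2]
    simp [rightStep]
  · simp only [if_true, hm] at hp hq hij' hjk'
    have h3 := hij'.eq_of_position_eq hjk' hm'
    obtain rfl := eq_of_mem_paths_of_nodup hnodup ht ha hp
    rw [h3.1.1, h3.1.2]
    simp [rightStep]

variable {R : Type*} [CommRing R] {z g : R}

/-- The colouring that contributes to the invariant: each crossing of the two circles is identified
with itself. -/
def identityColouring (b o : Bool) (c : ℕ) (X Y : List ℕ) (x₀ : LeftColour) (y₀ : RightColour) :
    List (ℕ × Colour × Colour) :=
  (c, .inr y₀, .inl x₀) :: X.map (leftStep b) ++ (c, .inl x₀, .inr y₀) :: Y.map (rightStep o)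

theorem weight_flatMap_pair {C : Type*} [DecidableEq C] {U : C → C → C → C → R}
    {f h : ℕ → ℕ × C × C} (hf : ∀ e, (f e).1 = e) (hh : ∀ e, (h e).1 = e) {w : List ℕ}
    (hw : w.Nodup) : weight U (w.flatMap fun e => [f e, h e])
      = (w.map fun e => U (f e).2.1 (f e).2.2 (h e).2.1 (h e).2.2).prod := by
  induction w with
  | nil => simp [weight]
  | cons e w ih =>
    rw [List.nodup_cons] at hw
    have hfe : f e = (e, (f e).2.1, (f e).2.2) := Prod.ext (hf e) rfl
    have hhe : h e = (e, (h e).2.1, (h e).2.2) := Prod.ext (hh e) rfl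
    rw [List.flatMap_cons, List.cons_append, List.cons_append, List.nil_append, List.map_cons,
      List.prod_cons, ← ih hw.2]
    conv_lhs => rw [hfe, hhe]
    refine weight_cons_cons ?_ ..
    simp only [List.mem_map, List.mem_flatMap, List.mem_cons, List.not_mem_nil, or_false]
    rintro ⟨a, ⟨e', he', rfl | rfl⟩, ha⟩
    · rw [hf] at ha; exact hw.1 (ha ▸ he')
    · rw [hh] at ha; exact hw.1 (ha ▸ he')

theorem trivialTensor_symm (i j k l : Colour) :
    trivialTensor z g i j k l = trivialTensor z g k l i j := by
  have hturn : ∀ i, turn (turn i) = i := turn_involutive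
  rcases i with i | i <;> rcases j with j | j <;> rcases k with k | k <;> rcases l with l | l <;>
    simp only [trivialTensor, tensor, bracket, delta, id] <;> grind

theorem weight_identityColouring {U : Colour → Colour → Colour → Colour → R}
    (hU : ∀ i j k l, U i j k l = U k l i j) {b o : Bool} {c : ℕ} (hc : c ∉ circleL1)
    {X Y : List ℕ} (hX : X ~r leftWord b) (hY : Y ~r rightWord o) (x₀ : LeftColour)
    (y₀ : RightColour) : weight U (identityColouring b o c X Y x₀ y₀) =
      U (.inr y₀) (.inl x₀) (.inl x₀) (.inr y₀) * (circleL1.map fun e =>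
        U (leftStep b e).2.1 (leftStep b e).2.2 (rightStep o e).2.1 (rightStep o e).2.2).prod := by
  have h1 : (X.map (leftStep b) ++ Y.map (rightStep o)).Perm
      (circleL1.flatMap fun e => [leftStep b e, rightStep o e]) :=
    (((hX.perm.trans (leftWord_perm b)).map _).append
      ((hY.perm.trans (rightWord_perm o)).map _)).trans (by
        rw [List.map_eq_flatMap (f := rightStep o)]
        exact List.map_append_flatMap_perm ..)
  rw [identityColouring, weight_perm hU (t := (c, .inr y₀, .inl x₀) :: (c, .inl x₀, .inr y₀) ::
    circleL1.flatMap fun e => [leftStep b e, rightStep o e]), weight_cons_cons,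
    weight_flatMap_pair (fun _ => rfl) (fun _ => rfl) (by decide)]
  · simp only [List.mem_map, List.mem_flatMap, List.mem_cons, List.not_mem_nil, or_false]
    rintro ⟨a, ⟨e, he, rfl | rfl⟩, rfl⟩
    · exact hc he
    · exact hc he
  · exact (List.perm_middle.trans (h1.cons _)).cons _

theorem jump_leftStep_rightStep (b o : Bool) (e : ℕ) :
    ∃ i j k l, leftStep b e = (e, .inl i, .inl j) ∧ rightStep o e = (e, .inr k, .inr l) ∧ i.2 = b ∧
      LeftJump (Fin.ofNat 11 e) i j ∧ RightJump (Fin.ofNat 11 e) k l := by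
  cases b <;> cases o <;>
    exact ⟨_, _, _, _, rfl, rfl, rfl, by simp [LeftJump], by simp [RightJump]⟩

theorem weight_linkTensor_identityColouring [CharP R 2] (hz : z * z = 0) (hg : g * g = 1)
    {b o : Bool} {c : ℕ} (hc : c ∉ circleL1) {X Y : List ℕ} (hX : X ~r leftWord b)
    (hY : Y ~r rightWord o) (x₀ : LeftColour) (y₀ : RightColour) :
    weight (linkTensor z g) (identityColouring b o c X Y x₀ y₀) = z * if b then g else 1 := by
  rw [weight_identityColouring (linkTensor_isInvariantTensor hz hg).symm hc hX hY]
  have h : ∀ e, linkTensor z g (leftStep b e).2.1 (leftStep b e).2.2 (rightStep o e).2.1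
      (rightStep o e).2.2 = if b then g else 1 := by
    intro e
    obtain ⟨i, j, k, l, h1, h2, h3, h4, h5⟩ := jump_leftStep_rightStep b o e
    have h6 : ∃ m, LeftJump m i j ∧ RightJump m k l := ⟨_, h4, h5⟩
    simp [h1, h2, linkTensor, tensor, linkCrossing, directionWeight, h3, h4.ne, h6]
  have h11 : g ^ 11 = g := by linear_combination (g ^ 9 + g ^ 7 + g ^ 5 + g ^ 3 + g) * hg
  simp only [h, List.map_const', List.prod_replicate]
  rw [show circleL1.length = 11 from rfl]
  cases b <;> simp [linkTensor, tensor, delta, h11]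

theorem weight_trivialTensor_identityColouring {b o : Bool} {c : ℕ} (hc : c ∉ circleL1)
    {X Y : List ℕ} (hX : X ~r leftWord b) (hY : Y ~r rightWord o) (x₀ : LeftColour)
    (y₀ : RightColour) :
    weight (trivialTensor z g) (identityColouring b o c X Y x₀ y₀) = 0 := by
  rw [weight_identityColouring trivialTensor_symm hc hX hY, List.prod_eq_zero, mul_zero]
  refine List.mem_map.mpr ⟨0, by decide, ?_⟩
  obtain ⟨i, j, k, l, h1, h2, -, h4, -⟩ := jump_leftStep_rightStep b o 0
  simp [h1, h2, trivialTensor, tensor, deletedCrossing, h4.ne]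

/-- Every colouring that contributes to the invariant is the identity colouring. -/
theorem IsContribution.eq_identityColouring {b o : Bool} {c : ℕ} (hc : c ∉ circleL1)
    {X Y : List ℕ} (hX : X ~r leftWord b) (hY : Y ~r rightWord o) {x₀ : LeftColour}
    {y₀ : RightColour} (hx : X.map (leftStep b) ∈ paths X (.inl x₀) (.inl x₀))
    (hy : Y.map (rightStep o) ∈ paths Y (.inr y₀) (.inr y₀)) {label : ℕ → Fin 11} {i : Colour}
    {s : List (ℕ × Colour × Colour)} (hs : s ∈ paths (c :: X ++ c :: Y) i i)
    (h : IsContribution (c :: X ++ c :: Y) c label s) :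
    i = .inr y₀ ∧ s = identityColouring b o c X Y x₀ y₀ := by
  have hX' : ∀ e, e ∈ X ↔ e ∈ circleL1 := fun e => by
    rw [hX.perm.mem_iff, (leftWord_perm b).mem_iff]
  have hY' : ∀ e, e ∈ Y ↔ e ∈ circleL1 := fun e => by
    rw [hY.perm.mem_iff, (rightWord_perm o).mem_iff]
  have hX0 : X ≠ [] := List.ne_nil_of_mem ((hX' 0).mpr (by decide))
  have hY0 : Y ≠ [] := List.ne_nil_of_mem ((hY' 0).mpr (by decide))
  obtain ⟨l, t₀, ht₀, u₀, hu₀, rfl⟩ := mem_paths_append.mp hs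
  obtain ⟨k, t, ht, rfl⟩ := mem_paths_cons.mp ht₀
  obtain ⟨k', u, hu, rfl⟩ := mem_paths_cons.mp hu₀
  clear ht₀ hu₀ hs
  have hstep : ∀ (v : List ℕ) (p q : Colour) (r : List (ℕ × Colour × Colour)),
      (∀ e, e ∈ v ↔ e ∈ circleL1) → r ∈ paths v p q →
      (∀ a ∈ r, a ∈ (c, i, k) :: t ++ (c, l, k') :: u) → ∀ a ∈ r,
      (∃ i j, a.2 = (.inl i, .inl j) ∧ LeftJump (label a.1) i j) ∨
        ∃ k l, a.2 = (.inr k, .inr l) ∧ RightJump (label a.1) k l := by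
    rintro v p q r hv hr hsub ⟨e, a, a'⟩ ha
    have he : e ∈ v := map_fst_of_mem_paths hr ▸ List.mem_map_of_mem ha
    rw [hv] at he
    have := h.step e (by simp [hX', he]) (fun h => hc (h ▸ he)) a a' (hsub _ ha)
    simpa [and_assoc] using this
  have hconst : ∀ (v : List ℕ) (p q : Colour) (r : List (ℕ × Colour × Colour)),
      r ∈ paths v p q → (∀ a ∈ r,
      (∃ i j, a.2 = (.inl i, .inl j) ∧ LeftJump (label a.1) i j) ∨
        ∃ k l, a.2 = (.inr k, .inr l) ∧ RightJump (label a.1) k l) →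
      p.isLeft = q.isLeft ∧
      (p.isLeft = true → ∀ a ∈ r, ∃ i j, a.2 = (.inl i, .inl j) ∧ LeftJump (label a.1) i j) ∧
      (p.isLeft = false → ∀ a ∈ r, ∃ i j, a.2 = (.inr i, .inr j) ∧ RightJump (label a.1) i j) := by
    intro v p q r hr hr'
    have h1 := constant_of_mem_paths Sum.isLeft hr (by
      intro a ha
      rcases hr' a ha with ⟨i, j, h1, -⟩ | ⟨i, j, h1, -⟩ <;> simp [h1])
    refine ⟨h1.1, fun hp a ha => ?_, fun hp a ha => ?_⟩ <;>
      rcases hr' a ha with h2 | ⟨i, j, h2, h3⟩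
    · exact h2
    · simpa [h2, hp] using h1.2 a ha
    · obtain ⟨i, j, h2, h3⟩ := h2
      simpa [h2, hp] using h1.2 a ha
    · exact ⟨i, j, h2, h3⟩
  obtain ⟨ht1, ht2, ht3⟩ := hconst X k l t ht (hstep X k l t hX' ht fun a ha => by simp [ha])
  obtain ⟨hu1, hu2, hu3⟩ := hconst Y k' i u hu (hstep Y k' i u hY' hu fun a ha => by simp [ha])
  obtain ⟨ι, κ, hswitch⟩ := h.switch
  have hs1 := hswitch i k (by simp)
  have hs2 := hswitch l k' (by simp)
  clear hswitch hstep hconst h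
  rcases hs1 with ⟨rfl, rfl⟩ | ⟨rfl, rfl⟩ <;> rcases hs2 with ⟨rfl, rfl⟩ | ⟨rfl, rfl⟩ <;>
    simp only [Sum.isLeft_inl, Sum.isLeft_inr, reduceCtorEq, true_imp_iff, false_imp_iff]
      at ht1 ht2 ht3 hu1 hu2 hu3
  · -- The families of colours are exchanged.
    exfalso
    obtain ⟨β, -, hβ⟩ := exists_direction_of_leftJump hu hu2
    refine labels_not_exchanged (L := fun m => label m) (b := β == o) (fun p => ?_) fun m => ?_
    · obtain ⟨v, hv⟩ := rightWord_consecutive o p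
      have h1 := hβ _ _ _ (hY.trans hv)
      cases o <;> cases β <;> simp at h1 ⊢ <;> simp [h1]
    · obtain ⟨v, hv⟩ := leftWord_consecutive b m
      have h1 := near_of_rightJump ht ht3 (hX.trans hv)
      cases b
      · exact h1.symm
      · exact h1
  · obtain ⟨β, hβ', hβ⟩ := exists_direction_of_leftJump ht ht2
    obtain ⟨hb, hlabel⟩ := labels_eq_id (L := fun m => label m) (b := β == b) (fun m => by
      obtain ⟨v, hv⟩ := leftWord_consecutive b m
      have h1 := hβ _ _ _ (hX.trans hv)
      cases b <;> cases β <;> simp at h1 ⊢ <;> simp [h1]) (fun p => by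
      obtain ⟨v, hv⟩ := rightWord_consecutive o p
      have h1 := near_of_rightJump hu hu3 (hY.trans hv)
      cases o
      · exact h1.symm
      · exact h1)
    obtain rfl : β = b := by simpa using hb
    obtain rfl := eq_map_leftStep hX ht ht2 hβ' hlabel
    obtain rfl := eq_map_rightStep hY hu hu3 hlabel
    have h1 := initial_unique_of_mem_paths hX0 ht hx
    have h2 := initial_unique_of_mem_paths hY0 hu hy
    rw [h1, h2]
    exact ⟨rfl, rfl⟩

/-- The value of the invariant on a lift of the link detects the orientation of the first
circle. All the colourings that are counted equally by the two tensors cancel, because the state sum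
of the trivial tensor vanishes. -/
theorem stateSum_lift [CharP R 2] (hz : z * z = 0) (hg : g * g = 1) {b o : Bool} {c : ℕ}
    {X Y : List ℕ} (hw : ∀ e ∈ c :: X ++ c :: Y, (c :: X ++ c :: Y).count e = 2)
    (hX : X ~r leftWord b) (hY : Y ~r rightWord o)
    (hlinked : ∀ d ∈ c :: X ++ c :: Y, d ≠ c →
      ∃ e ∈ c :: X ++ c :: Y, e ≠ d ∧ ¬ Alternate (c :: X ++ c :: Y) d e) :
    stateSum (linkTensor z g) (c :: X ++ c :: Y) = z * if b then g else 1 := by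
  have hX' : ∀ e, e ∈ X ↔ e ∈ circleL1 := fun e => by
    rw [hX.perm.mem_iff, (leftWord_perm b).mem_iff]
  have hY' : ∀ e, e ∈ Y ↔ e ∈ circleL1 := fun e => by
    rw [hY.perm.mem_iff, (rightWord_perm o).mem_iff]
  have hc : c ∉ circleL1 := by
    have h1 := hw c (by simp)
    simp only [List.count_append, List.count_cons_self] at h1
    rw [← hX', ← List.count_eq_zero]
    omega
  have hcard : (c :: X ++ c :: Y).toFinset.card = 12 := by
    have : (c :: X ++ c :: Y).toFinset = insert c circleL1.toFinset := by
      ext e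
      simp [hX', hY']
    rw [this, Finset.card_insert_of_notMem (by simpa using hc)]
    rfl
  obtain ⟨x₀, hx⟩ := exists_closed_leftStep hX
  obtain ⟨y₀, hy⟩ := exists_closed_rightStep hY
  have hmem : identityColouring b o c X Y x₀ y₀
      ∈ paths (c :: X ++ c :: Y) (.inr y₀) (.inr y₀) :=
    mem_paths_append.mpr ⟨_, _, mem_paths_cons.mpr ⟨_, _, hx, rfl⟩, _,
      mem_paths_cons.mpr ⟨_, _, hy, rfl⟩, rfl⟩
  have key : ∀ i, ∀ s ∈ paths (c :: X ++ c :: Y) i i,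
      weight (linkTensor z g) s - weight (trivialTensor z g) s ≠ 0 →
      i = .inr y₀ ∧ s = identityColouring b o c X Y x₀ y₀ := by
    intro i s hs hne
    obtain ⟨d, hd, label, h⟩ := exists_isContribution hw hcard hs (sub_ne_zero.mp hne)
    obtain rfl : d = c := by
      by_contra hdc
      obtain ⟨e, he, hed, hde⟩ := hlinked d hd hdc
      exact hde (h.alternate hw hd hs he hed)
    exact h.eq_identityColouring hc hX hY hx hy hs
  have h1 : stateSum (linkTensor z g) (c :: X ++ c :: Y)
      = ∑ i, ∑ s ∈ paths (c :: X ++ c :: Y) i i,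
        (weight (linkTensor z g) s - weight (trivialTensor z g) s) := by
    simp only [Finset.sum_sub_distrib]
    rw [← stateSum, ← stateSum, stateSum_eq_zero recolour_involutive recolour_ne
      (trivialTensor_recolour z g), sub_zero]
  rw [h1, Finset.sum_eq_single (.inr y₀), Finset.sum_eq_single (identityColouring b o c X Y x₀ y₀),
    weight_linkTensor_identityColouring hz hg hc hX hY,
    weight_trivialTensor_identityColouring hc hX hY, sub_zero]
  · intro s hs hne
    by_contra h
    exact hne (key _ s hs h).2
  · exact fun h => absurd hmem h
  · intro i _ hi
    refine Finset.sum_eq_zero fun s hs => ?_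
    by_contra h
    exact hi (key i s hs h).1
  · simp

end Evaluation

/-! ### The lifts of the link and their inverses -/

section Lifts

theorem Alternate.of_isRotated {w w' : List ℕ} {c d : ℕ} (h : w ~r w') (hcd : Alternate w' c d) :
    Alternate w c d := by
  obtain ⟨x, y, hxy, hd⟩ := hcd
  exact ⟨x, y, h.trans hxy, hd⟩

theorem Alternate.map {w : List ℕ} {c d : ℕ} (h : Alternate w c d) (σ : ℕ → ℕ) :
    Alternate (w.map σ) (σ c) (σ d) := by
  obtain ⟨x, y, hxy, hx, hy⟩ := h
  exact ⟨x.map σ, y.map σ, by simpa using hxy.map σ, List.mem_map_of_mem hx, List.mem_map_of_mem hy⟩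

theorem isRotated_reverse_of_isRotated {w x y : List ℕ} {c : ℕ} (h : w ~r c :: x ++ c :: y) :
    w.reverse ~r c :: x.reverse ++ c :: y.reverse := by
  refine h.reverse.trans ?_
  have := List.isRotated_append (l := y.reverse) (l' := c :: x.reverse ++ [c])
  simpa using this

theorem Alternate.reverse {w : List ℕ} {c d : ℕ} (h : Alternate w c d) :
    Alternate w.reverse c d := by
  obtain ⟨x, y, hxy, hx, hy⟩ := h
  exact ⟨_, _, isRotated_reverse_of_isRotated hxy, by simpa using hx, by simpa using hy⟩

variable {R : Type*} [CommRing R] {z g : R}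

theorem stateSum_eq_of_isRotated {C : Type*} [Fintype C] [DecidableEq C] {U : C → C → C → C → R}
    (hU : ∀ i j k l, U i j k l = U k l i j) {w w' : List ℕ} (h : w ~r w') :
    stateSum U w = stateSum U w' := by
  obtain ⟨n, rfl⟩ := h
  rw [List.rotate_eq_drop_append_take_mod, ← stateSum_rotate hU, List.take_append_drop]

theorem stateSum_of_smoothing [CharP R 2] (hz : z * z = 0) (hg : g * g = 1) {b o : Bool} {c : ℕ}
    {w X Y : List ℕ} (hw : ∀ e ∈ w, w.count e = 2) (hXY : w ~r c :: X ++ c :: Y)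
    (σ : Equiv.Perm ℕ) (hX : X.map σ ~r leftWord b) (hY : Y.map σ ~r rightWord o)
    (hlinked : ∀ d ∈ w, d ≠ c → ∃ e ∈ w, e ≠ d ∧ ¬ Alternate w d e) :
    stateSum (linkTensor z g) w = z * if b then g else 1 := by
  have h1 : w.map σ ~r σ c :: X.map σ ++ σ c :: Y.map σ := by simpa using hXY.map σ
  have hmem : ∀ e, e ∈ σ c :: X.map σ ++ σ c :: Y.map σ ↔ σ.symm e ∈ w := fun e => by
    rw [← h1.perm.mem_iff, List.mem_map]
    exact ⟨fun ⟨a, ha, h⟩ => by rwa [← h, σ.symm_apply_apply],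
      fun h => ⟨_, h, σ.apply_symm_apply e⟩⟩
  rw [← stateSum_map σ.injective,
    stateSum_eq_of_isRotated (linkTensor_isInvariantTensor hz hg).symm h1]
  refine stateSum_lift hz hg (fun e he => ?_) hX hY fun d hd hdc => ?_
  · rw [← h1.perm.count_eq]
    obtain ⟨a, ha, rfl⟩ := List.mem_map.mp (h1.perm.mem_iff.mpr he)
    rw [List.count_map_of_injective _ _ σ.injective, hw a ha]
  · obtain ⟨e, he, hed, hde⟩ := hlinked (σ.symm d) ((hmem d).mp hd) fun h => hdc (by simp [← h])
    refine ⟨σ e, (hmem _).mpr (by simpa using he), fun h => hed (by simp [← h]), fun h => hde ?_⟩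
    simpa using (h.of_isRotated h1).map σ.symm

theorem exists_leftWord {X : List ℕ} (h : SameCircle X circleL1) : ∃ b, X ~r leftWord b := by
  rcases h with h | h
  · exact ⟨true, h⟩
  · exact ⟨false, h⟩

theorem exists_rightWord {Y : List ℕ} (h : SameCircle Y circleL2) : ∃ o, Y ~r rightWord o := by
  rcases h with h | h
  · exact ⟨true, h⟩
  · exact ⟨false, h⟩

theorem leftWord_reverse (b : Bool) : (leftWord b).reverse = leftWord !b := by
  revert b; decide

theorem rightWord_reverse (o : Bool) : (rightWord o).reverse = rightWord !o := by
  revert o; decide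

/-- There is a ring of coefficients that distinguishes the two directions. -/
theorem exists_coefficients : ∃ (R : Type) (_ : CommRing R) (_ : CharP R 2) (z g : R),
    z * z = 0 ∧ g * g = 1 ∧ z * g ≠ z := by
  let z : DualNumber (DualNumber (ZMod 2)) := DualNumber.eps
  let y : DualNumber (DualNumber (ZMod 2)) := TrivSqZeroExt.inl DualNumber.eps
  have hchar : CharP (DualNumber (DualNumber (ZMod 2))) 2 :=
    charP_of_injective_algebraMap (algebraMap (ZMod 2) _).injective 2
  have hz : z * z = 0 := DualNumber.eps_mul_eps
  have hy : y * y = 0 := by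
    rw [← TrivSqZeroExt.inl_mul, DualNumber.eps_mul_eps, TrivSqZeroExt.inl_zero]
  refine ⟨_, inferInstance, hchar, z, 1 + y, hz, ?_, fun h => ?_⟩
  · have h2 : (2 : DualNumber (DualNumber (ZMod 2))) = 0 := CharTwo.two_eq_zero
    linear_combination hy + y * h2
  · rw [mul_one_add, add_eq_left] at h
    have := congrArg (fun a => TrivSqZeroExt.snd (TrivSqZeroExt.snd a)) h
    simp [z, y] at this

theorem not_equivalent_inverse {K : GaussDiagram} (hK : IsLiftOfL K) :
    ¬ K.Equivalent K.inverse := by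
  obtain ⟨R, _, _, z, g, hz, hg, hne⟩ := exists_coefficients
  obtain ⟨hunique, c, X, Y, hc, hXY, σ, hX, hY⟩ := hK
  obtain ⟨b, hb⟩ := exists_leftWord hX
  obtain ⟨o, ho⟩ := exists_rightWord hY
  have hlinked : ∀ d ∈ K.word, d ≠ c → ∃ e ∈ K.word, e ≠ d ∧ ¬ Alternate K.word d e := by
    intro d hd hdc
    by_contra! h
    exact hdc (hunique.unique ⟨hd, h⟩ hc)
  have h1 := stateSum_of_smoothing hz hg K.double hXY σ hb ho hlinked
  have h2 := stateSum_of_smoothing hz hg K.inverse.double (isRotated_reverse_of_isRotated hXY) σ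
    (b := !b) (o := !o) (by rw [List.map_reverse, ← leftWord_reverse]; exact hb.reverse)
    (by rw [List.map_reverse, ← rightWord_reverse]; exact ho.reverse) (by
      intro d hd hdc
      obtain ⟨e, he, hed, hde⟩ := hlinked d (List.mem_reverse.mp hd) hdc
      refine ⟨e, List.mem_reverse.mpr he, hed, fun h => hde ?_⟩
      have := h.reverse
      rwa [GaussDiagram.inverse, List.reverse_reverse] at this)
  intro h
  have h3 := stateSum_eq_of_equivalent (linkTensor_isInvariantTensor hz hg) h
  rw [h1, h2] at h3
  cases b
  · exact hne (by simpa using h3.symm)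
  · exact hne (by simpa using h3)

/-- The ends of alternating chords form the cyclic word `cdcd`. -/
theorem Alternate.filter_isRotated {w : List ℕ} {c d : ℕ} (h : Alternate w c d)
    (hc : w.count c = 2) (hd : w.count d = 2) (hcd : c ≠ d) :
    w.filter (fun a => a = c ∨ a = d) ~r [c, d, c, d] := by
  obtain ⟨x, y, hxy, hx, hy⟩ := h
  have hfilter : ∀ {v v' : List ℕ}, v ~r v' →
      v.filter (fun a => a = c ∨ a = d) ~r v'.filter (fun a => a = c ∨ a = d) := by
    rintro v _ ⟨n, rfl⟩
    rw [List.rotate_eq_drop_append_take_mod]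
    conv_lhs => rw [← List.take_append_drop (n % v.length) v]
    rw [List.filter_append, List.filter_append]
    exact List.isRotated_append
  refine (hfilter hxy).trans ?_
  rw [hxy.perm.count_eq] at hc hd
  simp only [List.count_append, List.count_cons_self, List.count_cons_of_ne hcd] at hc hd
  have hx' := List.count_pos_iff.mpr hx
  have hy' := List.count_pos_iff.mpr hy
  have key : ∀ v : List ℕ, v.count c = 0 → v.count d = 1 →
      v.filter (fun a => a = c ∨ a = d) = [d] := by
    intro v hvc hvd
    rw [List.count_eq_zero] at hvc
    rw [show [d] = List.replicate (v.count d) d by simp [hvd], ← List.filter_eq]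
    refine List.filter_congr fun a ha => ?_
    have : a ≠ c := fun h => hvc (h ▸ ha)
    simp [this]
  rw [List.filter_append, List.filter_cons_of_pos (by simp), List.filter_cons_of_pos (by simp),
    key x (by omega) (by omega), key y (by omega) (by omega)]
  rfl

theorem isLiftOfL_diagramK : IsLiftOfL diagramK := by
  have h11 : diagramK.LinkedWithAll 11 := by
    refine ⟨by decide, fun d hd hd' => ⟨[0, 1, 2, 3, 4, 5, 6, 7, 8, 9, 10],
      [6, 10, 2, 9, 5, 3, 7, 0, 8, 4, 1], .refl _, ?_⟩⟩
    revert d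
    decide
  refine ⟨⟨11, h11, fun c ⟨hc, hc'⟩ => ?_⟩, 11, [0, 1, 2, 3, 4, 5, 6, 7, 8, 9, 10],
      [6, 10, 2, 9, 5, 3, 7, 0, 8, 4, 1], h11, .refl _, .refl _, .inl ?_, .inl ?_⟩
  · have key : ∀ c ∈ diagramK.word, c ≠ 11 → ∃ d ∈ diagramK.word, d ≠ c ∧
        ¬ diagramK.word.filter (fun a => a = c ∨ a = d) ~r [c, d, c, d] := by
      decide
    by_contra hc11
    obtain ⟨d, hd, hdc, h⟩ := key c hc hc11
    exact h (Alternate.filter_isRotated (hc' d hd hdc) (diagramK.double c hc)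
      (diagramK.double d hd) hdc.symm)
  · exact ⟨0, rfl⟩
  -- the second component begins seven places before the crossing `0`
  · exact ⟨7, rfl⟩

end Lifts

end FreeKnots

theorem mainTheorem1 :
    FreeKnots.IsLiftOfL FreeKnots.diagramK ∧
      ∀ K : FreeKnots.GaussDiagram, FreeKnots.IsLiftOfL K → ¬ K.Equivalent K.inverse :=
  ⟨FreeKnots.isLiftOfL_diagramK, fun _ hK => FreeKnots.not_equivalent_inverse hK⟩
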